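/- Let $\mathbb{D}$ be the unit disc, $A$ its normalized area measure and $\mathbb{T}$ the unit circle. For $I\subseteq\mathbb{T}$ let $|I|$ be its normalized arc length ($|\mathbb{T}|=1$), and put $$S(I)=\{z\in\mathbb{D}: z/|z|\in I,\ 1-|z|<|I|\},\qquad T(I)=\{z\in\mathbb{D}: z/|z|\in I,\ \tfrac12<\tfrac{1-|z|}{|I|}\le 1\}$$ (with the convention $0\in T(\mathbb{T})$). A dyadic grid is a collection $\mathcal{D}$ of arcs, each containing its right but not its left endpoint and each of length $2^{-n}$ for some integer $n\ge 0$, such that $\mathbb{T}\in\mathcal{D}$ and, for every $I\in\mathcal{D}$, the family $\{J\in\mathcal{D}:|J|=|I|\}$ is a partition of $\mathbb{T}$ and $I$ is the union of two disjoint arcs of $\mathcal{D}$ of equal length. For $z\in\mathbb{D}$, let $\mathcal{I}_z$ be the unique arc in $\mathcal{D}$ with $z\in T(\mathcal{I}_z)$, and define $$\beta_{\mathcal{D}}(z,\zeta)=\log_2\frac{|P|}{\min\{|\mathcal{I}_z|,|\mathcal{I}_\zeta|\}},$$ where $P$ is the smallest arc in $\mathcal{D}$ containing $\mathcal{I}_z$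 and $\mathcal{I}_\zeta$. For measurable $\Omega\subseteq\mathbb{D}$ and $1<p<\infty$, a nonnegative integrable function $w$ on $\Omega$ belongs to $B_{p,\mathcal{D},\Omega}$ if $$[w]_{B_{p,\mathcal{D},\Omega}}=\sup_{I\in\mathcal{D}}\frac{1}{A(S(I))}\int_{S(I)\cap\Omega}w\,dA\left(\frac{1}{A(S(I))}\int_{S(I)\cap\Omega}w^{-\frac1{p-1}}\,dA\right)^{p-1}<\infty;$$ write $B_{p,\mathcal{D}}$ and $[w]_{B_{p,\mathcal{D}}}$ when $\Omega=\mathbb{D}$. A measurable, almost everywhere positive function $w$ on $\Omega$ is of dyadic bounded hyperbolic oscillation in $\Omega$ if there is a constant $L\ge 0$ such that $|\log w(z)-\log w(\zeta)|\le L(1+\beta_{\mathcal{D}}(z,\zeta))$ for almost every $z,\zeta\in\Omega$; the smallest such $L$ is denoted $L_w$. **Theorem.** Let $\mathcal{D}$ be a dyadic grid, let $1<p<\infty$, and let $\Omega=\bigcup_{I\in\mathcal{J}}T(I)$ for some $\mathcal{J}\subseteq\mathcal{D}$. (a) Let $w$ be of dyadic bounded hyperbolic oscillation in $\Omega$, and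 suppose that $w^q\in B_{p,\mathcal{D},\Omega}$ for some $q>1$. Then there exists $W\in B_{p,\mathcal{D}}$ of dyadic bounded hyperbolic oscillation in $\mathbb{D}$ such that $W(z)=w(z)$ for almost every $z\in\Omega$, and $$[W]_{B_{p,\mathcal{D}}}\le M_1,\qquad L_W\le M_2,$$ where $M_1$ and $M_2$ depend only on $q$, $p$, $L_w$ and $[w^q]_{B_{p,\mathcal{D},\Omega}}$. (b) Conversely, if $w$ coincides almost everywhere in $\Omega$ with some $W\in B_{p,\mathcal{D}}$ of dyadic bounded hyperbolic oscillation in $\mathbb{D}$, then there exists $q>1$ such that $w^q\in B_{p,\mathcal{D},\Omega}$. -/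

import Mathlib

open MeasureTheory Set
open scoped ENNReal

namespace DyadicWeights

noncomputable section

/-- The half-open arc `{e^{2πit} : a < t ≤ a + l}` of the unit circle `𝕋`: it contains its right
endpoint, but not its left one (for `l = 1` it is all of `𝕋`). -/
def arc (a l : ℝ) : Set Circle :=
  (fun t : ℝ => Circle.exp (2 * Real.pi * t)) '' Ioc a (a + l)

/-- Normalized arc length `|I|` of a set `I ⊆ 𝕋`, so that `|𝕋| = 1`. -/
def arcLength (I : Set Circle) : ℝ :=
  (volume {t : ℝ | t ∈ Ioc (0 : ℝ) 1 ∧ Circle.exp (2 * Real.pi * t) ∈ I}).toReal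

/-- A dyadic grid of the unit circle. The condition `dyadic` on the lengths is what makes the
top halves `topHalf I`, for `I ∈ D`, tile the disc. -/
structure IsDyadicGrid (D : Set (Set Circle)) : Prop where
  /-- The members of `D` are half-open arcs. -/
  isArc : ∀ I ∈ D, ∃ a l : ℝ, 0 < l ∧ l ≤ 1 ∧ I = arc a l
  /-- The lengths are `1, 1/2, 1/4, …`. -/
  dyadic : ∀ I ∈ D, ∃ n : ℕ, arcLength I = (1 / 2 : ℝ) ^ n
  /-- The whole circle belongs to `D`. -/
  univ_mem : univ ∈ D
  /-- The arcs of a given length that occurs in `D` form a partition of the circle. -/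
  partition : ∀ I ∈ D, Setoid.IsPartition {J : Set Circle | J ∈ D ∧ arcLength J = arcLength I}
  /-- Every arc of `D` is the union of two arcs of `D`, its halves. -/
  halves : ∀ I ∈ D, ∃ I₁ ∈ D, ∃ I₂ ∈ D,
    arcLength I₁ = arcLength I₂ ∧ Disjoint I₁ I₂ ∧ I = I₁ ∪ I₂

/-- The open unit disc `𝔻`. -/
def disc : Set ℂ := Metric.ball 0 1

/-- Normalized area measure `A` of the unit disc, `A(𝔻) = 1`. -/
def area : Measure ℂ := (ENNReal.ofReal Real.pi)⁻¹ • volume.restrict disc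

/-- The sector of the points `z` in the disc with `z / |z| ∈ I` (`z = 0` belongs to it, if `I` is
nonempty). -/
def sector (I : Set Circle) : Set ℂ := {z | z ∈ disc ∧ ∃ ζ ∈ I, z = (‖z‖ : ℂ) * (ζ : ℂ)}

/-- The Carleson square `S(I) = {z ∈ 𝔻 : z / |z| ∈ I, 1 - |z| < |I|}`. -/
def carlesonSquare (I : Set Circle) : Set ℂ := {z | z ∈ sector I ∧ 1 - ‖z‖ < arcLength I}

/-- The top half `T(I) = {z ∈ 𝔻 : z / |z| ∈ I, 1 / 2 < (1 - |z|) / |I| ≤ 1}`. -/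
def topHalf (I : Set Circle) : Set ℂ :=
  {z | z ∈ sector I ∧ 1 / 2 < (1 - ‖z‖) / arcLength I ∧ (1 - ‖z‖) / arcLength I ≤ 1}

/-- The arc `𝓘_z`: the unique member `I` of the grid with `z ∈ T(I)` (here written as the union of
all such `I`, for `z ∈ 𝔻` there is exactly one). -/
def gridArc (D : Set (Set Circle)) (z : ℂ) : Set Circle := ⋃₀ {I | I ∈ D ∧ z ∈ topHalf I}

/-- `P_D(I, J)`, the smallest arc of the grid that contains both `I` and `J` (here written as the
intersection of all arcs of the grid containing both; for nonempty `I` these form a finite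
chain). -/
def commonArc (D : Set (Set Circle)) (I J : Set Circle) : Set Circle :=
  ⋂₀ {K | K ∈ D ∧ I ⊆ K ∧ J ⊆ K}

/-- The dyadic hyperbolic distance
`β_D(z, ζ) = log₂ (|P_D(𝓘_z, 𝓘_ζ)| / min (|𝓘_z|, |𝓘_ζ|))`. -/
def dyadicDist (D : Set (Set Circle)) (z ζ : ℂ) : ℝ :=
  Real.logb 2 (arcLength (commonArc D (gridArc D z) (gridArc D ζ)) /
    min (arcLength (gridArc D z)) (arcLength (gridArc D ζ)))

/-- The Békollé--Bonami constant `[w]_{B_{p,D,Ω}}`, as an extended nonnegative real. Only the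
values of `w` on `Ω` matter. -/
def bpConst (D : Set (Set Circle)) (Ω : Set ℂ) (p : ℝ) (w : ℂ → ℝ) : ℝ≥0∞ :=
  ⨆ I ∈ D,
    ((∫⁻ z in carlesonSquare I ∩ Ω, ENNReal.ofReal (w z) ∂area) / area (carlesonSquare I)) *
    ((∫⁻ z in carlesonSquare I ∩ Ω, ENNReal.ofReal (w z) ^ (-1 / (p - 1)) ∂area) /
      area (carlesonSquare I)) ^ (p - 1)

/-- `w ∈ B_{p,D,Ω}`: `w` is nonnegative and integrable on `Ω`, and `[w]_{B_{p,D,Ω}} < ∞`. -/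
structure MemBp (D : Set (Set Circle)) (Ω : Set ℂ) (p : ℝ) (w : ℂ → ℝ) : Prop where
  nonneg : ∀ᵐ z ∂area.restrict Ω, 0 ≤ w z
  integrable : IntegrableOn w Ω area
  const_lt_top : bpConst D Ω p w < ∞

/-- `|log w(z) - log w(ζ)| ≤ L (1 + β_D(z, ζ))` for almost every `z` and `ζ` in `Ω`. -/
def OscBound (D : Set (Set Circle)) (Ω : Set ℂ) (w : ℂ → ℝ) (L : ℝ) : Prop :=
  ∀ᵐ z ∂area.restrict Ω, ∀ᵐ ζ ∂area.restrict Ω,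
    |Real.log (w z) - Real.log (w ζ)| ≤ L * (1 + dyadicDist D z ζ)

/-- `w` is a (measurable, positive) weight on `Ω` of dyadic bounded hyperbolic oscillation. -/
structure IsDyadicBHO (D : Set (Set Circle)) (Ω : Set ℂ) (w : ℂ → ℝ) : Prop where
  aemeasurable : AEMeasurable w (area.restrict Ω)
  pos : ∀ᵐ z ∂area.restrict Ω, 0 < w z
  exists_bound : ∃ L : ℝ, 0 ≤ L ∧ OscBound D Ω w L

/-- The oscillation constant `L_w`, the smallest admissible `L ≥ 0`. -/
def oscConst (D : Set (Set Circle)) (Ω : Set ℂ) (w : ℂ → ℝ) : ℝ :=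
  sInf {L : ℝ | 0 ≤ L ∧ OscBound D Ω w L}

end

end DyadicWeights

/-! Part (a). Put `r = 1 / (p - 1)`, and let `f` and `s` be `w ^ q` and its dual weight `w ^ (-q
r)`, extended by zero off `Ω`. After rescaling `s`, the Békollé--Bonami condition says that `avg f ≤
(avg s) ^ (-1 / r)` over every Carleson square: two barriers on the tree of grid arcs, in the right
order. Starting at the root, let `V I` be the value at the parent of `I`, projected onto the
interval between the barriers at `I` (`exists_between`). Thus `V` rises only to averages of `f`, and
`V ^ (-r)` rises only to averages of `s`. Bounded oscillation makes `w ^ q` comparable to `V` on the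
tiles in `Ω`. Hence `W`, equal to `w` on `Ω` and to `V ^ (1 / q)` elsewhere, is comparable to `V ^
(1 / q)` on every tile. Averages at most quadruple from an arc to its half, so `log V` has bounded
jumps and `W` has bounded oscillation. As `1 / q < 1`, Kolmogorov's inequality on the tree
(`lintegral_box_le_of_avg_le`) bounds the average of `V ^ (1 / q)` over the square of `I` by a
constant times `V I ^ (1 / q)`, and likewise for `V ^ (-r / q)`. In the product defining the `B_p`
constant the powers of `V I` cancel. Part (b). The `B_p` condition and bounded oscillation make `W`
and its dual weight comparable, on each tile, to their averages over the Carleson square. Every tile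
then carries a fixed share of the mass of its square, which gives a reverse Hölder inequality by
induction on generations (`lintegral_box_rpow_le`), with one exponent for both weights. -/

namespace DyadicWeights

/-! ### Arc length, and the area of a truncated sector. -/

section Arcs

/-- The set of the parameters `t` with `e^{2πit} ∈ I`. -/
def angleSet (I : Set Circle) : Set ℝ := {t | Circle.exp (2 * Real.pi * t) ∈ I}

lemma angleSet_arc (a l : ℝ) : angleSet (arc a l) = ⋃ n : ℤ, Ioc (a + n) (a + l + n) := by
  ext t
  simp only [angleSet, arc, mem_ofPred_eq, mem_image, mem_iUnion, mem_Ioc]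
  constructor
  · rintro ⟨x, ⟨h1, h2⟩, h⟩
    obtain ⟨m, hm⟩ := Circle.exp_eq_exp.1 h
    have : x = t + m := by
      have := Real.pi_pos
      field_simp at hm
      linarith
    refine ⟨-m, ?_, ?_⟩ <;> push_cast <;> linarith
  · rintro ⟨n, h1, h2⟩
    refine ⟨t - n, ⟨by linarith, by linarith⟩, ?_⟩
    rw [Circle.exp_eq_exp]
    exact ⟨-n, by push_cast; ring⟩

lemma measurableSet_angleSet_arc (a l : ℝ) : MeasurableSet (angleSet (arc a l)) := by
  rw [angleSet_arc]
  exact MeasurableSet.iUnion fun n => measurableSet_Ioc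

/-- The set of parameters has period 1, and every half-open unit interval is a fundamental domain
for the integer translations. This moves arc length from `(0, 1]` to a window symmetric about 0, as
the range of `Complex.arg` requires. -/
lemma volume_Ioc_inter_angleSet {I : Set Circle} (hI : MeasurableSet (angleSet I)) (x y : ℝ) :
    volume (angleSet I ∩ Ioc x (x + 1)) = volume (angleSet I ∩ Ioc y (y + 1)) := by
  refine (isAddFundamentalDomain_Ioc one_pos x volume).measure_set_eq
    (isAddFundamentalDomain_Ioc one_pos y volume) hI ?_
  rintro ⟨g, hg⟩
  obtain ⟨n, rfl⟩ := AddSubgroup.mem_zmultiples_iff.1 hg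
  ext t
  simp only [angleSet, mem_preimage, mem_ofPred_eq]
  have : Circle.exp (2 * Real.pi * ((⟨n • (1 : ℝ), hg⟩ : AddSubgroup.zmultiples (1 : ℝ)) +ᵥ t))
      = Circle.exp (2 * Real.pi * t) := by
    rw [Circle.exp_eq_exp]
    refine ⟨n, ?_⟩
    change 2 * Real.pi * (n • (1 : ℝ) + t) = _
    simp only [zsmul_eq_mul, mul_one]
    ring
  rw [this]

lemma arcLength_eq {I : Set Circle} (hI : MeasurableSet (angleSet I)) (x : ℝ) :
    arcLength I = (volume (angleSet I ∩ Ioc x (x + 1))).toReal := by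
  rw [volume_Ioc_inter_angleSet hI x 0, arcLength, inter_comm, zero_add]
  rfl

lemma arcLength_nonneg (I : Set Circle) : 0 ≤ arcLength I := ENNReal.toReal_nonneg

lemma arcLength_union {I J : Set Circle} (hI : MeasurableSet (angleSet I))
    (hJ : MeasurableSet (angleSet J)) (h : Disjoint I J) :
    arcLength (I ∪ J) = arcLength I + arcLength J := by
  have hu : angleSet (I ∪ J) = angleSet I ∪ angleSet J := rfl
  rw [arcLength_eq (hu ▸ hI.union hJ) 0, arcLength_eq hI 0, arcLength_eq hJ 0, hu,
    union_inter_distrib_right, measure_union, ENNReal.toReal_add]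
  · exact (measure_mono inter_subset_right).trans_lt (by simp) |>.ne
  · exact (measure_mono inter_subset_right).trans_lt (by simp) |>.ne
  · rw [Set.disjoint_left] at h ⊢
    exact fun t ht ht' => h ht.1 ht'.1
  · exact hJ.inter measurableSet_Ioc

lemma volume_angle {I : Set Circle} (hI : MeasurableSet (angleSet I)) :
    volume ({θ | Circle.exp θ ∈ I} ∩ Ioo (-Real.pi) Real.pi) =
      ENNReal.ofReal (2 * Real.pi * arcLength I) := by
  have h1 : volume (angleSet I ∩ Ioo (-(1 / 2) : ℝ) (1 / 2)) = ENNReal.ofReal (arcLength I) := by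
    rw [arcLength_eq hI (-(1 / 2)), ENNReal.ofReal_toReal]
    · have : (-(1 / 2) + 1 : ℝ) = 1 / 2 := by norm_num
      rw [this]
      exact measure_congr ((Filter.EventuallyEq.refl _ _).inter Ioo_ae_eq_Ioc)
    · exact (measure_mono inter_subset_right).trans_lt (by simp) |>.ne
  have hpi := Real.pi_pos
  have h2 : angleSet I ∩ Ioo (-(1 / 2) : ℝ) (1 / 2) =
      (fun x => 2 * Real.pi * x) ⁻¹' ({θ | Circle.exp θ ∈ I} ∩ Ioo (-Real.pi) Real.pi) := by
    ext t
    simp only [angleSet, mem_inter_iff, mem_ofPred_eq, mem_Ioo, mem_preimage]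
    refine and_congr_right fun _ => and_congr ?_ ?_
    · constructor <;> intro h <;> nlinarith
    · constructor <;> intro h <;> nlinarith
  rw [h2, Real.volume_preimage_mul_left (by positivity)] at h1
  rw [ENNReal.ofReal_mul (by positivity), ← h1, ← mul_assoc, ← ENNReal.ofReal_mul (by positivity),
    abs_of_pos (by positivity), mul_inv_cancel₀ (by positivity)]
  simp

/-- The part `{z ∈ 𝔻 : z / |z| ∈ I, s < 1 - |z| ≤ t}` of the sector over `I`. -/
def shell (I : Set Circle) (s t : ℝ) : Set ℂ := {z | z ∈ sector I ∧ s < 1 - ‖z‖ ∧ 1 - ‖z‖ ≤ t}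

/-- The origin is excluded because it lies in the sector over every nonempty arc, whatever its
argument. -/
lemma mem_sector_iff {I : Set Circle} {z : ℂ} (hz : z ≠ 0) :
    z ∈ sector I ↔ ‖z‖ < 1 ∧ Circle.exp z.arg ∈ I := by
  simp only [sector, disc, mem_ofPred_eq, Metric.mem_ball, dist_zero_right]
  refine and_congr_right fun _ => ?_
  have h0 : (‖z‖ : ℂ) ≠ 0 := by simpa using hz
  have key : z = (‖z‖ : ℂ) * (Circle.exp z.arg : ℂ) := by
    rw [Circle.coe_exp, Complex.norm_mul_exp_arg_mul_I]
  constructor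
  · rintro ⟨ζ, hζ, h⟩
    have : (ζ : ℂ) = Circle.exp z.arg := mul_left_cancel₀ h0 (h.symm.trans key)
    rwa [← Circle.ext this]
  · intro h
    exact ⟨_, h, key⟩

lemma measurableSet_angle {I : Set Circle} (hI : MeasurableSet (angleSet I)) :
    MeasurableSet {θ : ℝ | Circle.exp θ ∈ I} := by
  have : {θ : ℝ | Circle.exp θ ∈ I} = (fun x => (2 * Real.pi)⁻¹ * x) ⁻¹' angleSet I := by
    ext θ
    have := Real.pi_pos
    simp only [angleSet, mem_ofPred_eq, mem_preimage]
    rw [mul_inv_cancel_left₀ (by positivity)]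
  rw [this]
  exact (measurable_const_mul _) hI

lemma measurableSet_sector {I : Set Circle} (hI : MeasurableSet (angleSet I)) :
    MeasurableSet (sector I) := by
  have h1 : MeasurableSet {z : ℂ | z ≠ 0 ∧ ‖z‖ < 1 ∧ Circle.exp z.arg ∈ I} :=
    (measurableSet_singleton (0 : ℂ)).compl.inter
      ((measurableSet_lt measurable_norm measurable_const).inter
        (Complex.measurable_arg (measurableSet_angle hI)))
  have h2 : sector I = {z : ℂ | z ≠ 0 ∧ ‖z‖ < 1 ∧ Circle.exp z.arg ∈ I} ∪ (sector I ∩ {0}) := by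
    ext z
    by_cases hz : z = 0
    · simp [hz]
    · simp only [mem_union, mem_ofPred_eq, mem_inter_iff, mem_singleton_iff, hz, and_false, or_false,
        ne_eq, not_false_eq_true, true_and, mem_sector_iff hz]
  rw [h2]
  exact h1.union ((Set.finite_singleton (0 : ℂ)).subset inter_subset_right).measurableSet

lemma measurableSet_shell {I : Set Circle} (hI : MeasurableSet (angleSet I)) (s t : ℝ) :
    MeasurableSet (shell I s t) :=
  (measurableSet_sector hI).inter ((measurableSet_lt measurable_const
    (measurable_const.sub measurable_norm)).inter
    (measurableSet_le (measurable_const.sub measurable_norm) measurable_const))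

lemma lintegral_id_Ico {a b : ℝ} (ha : 0 ≤ a) (hab : a ≤ b) :
    ∫⁻ r in Ico a b, ENNReal.ofReal r = ENNReal.ofReal ((b ^ 2 - a ^ 2) / 2) := by
  rw [← ofReal_integral_eq_lintegral_ofReal, integral_Ico_eq_integral_Ioc,
    ← intervalIntegral.integral_of_le hab, integral_id]
  · exact (continuous_id.integrableOn_Icc (μ := volume)).mono_set Ico_subset_Icc_self
  · filter_upwards [ae_restrict_mem measurableSet_Ico] with r hr using ha.trans hr.1

/-- In polar coordinates the set is a product of `1 - t ≤ r < 1 - s` with a set of angles, and the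
density `r` factors off. -/
lemma area_shell {I : Set Circle} (hI : MeasurableSet (angleSet I)) {s t : ℝ} (hs : 0 ≤ s)
    (hst : s ≤ t) (ht : t ≤ 1) :
    area (shell I s t) = ENNReal.ofReal (arcLength I * ((1 - s) ^ 2 - (1 - t) ^ 2)) := by
  have hpi := Real.pi_pos
  have hm := measurableSet_shell hI s t
  have hsub : shell I s t ⊆ disc := fun z hz => hz.1.1
  have hvol : volume (shell I s t) =
      ENNReal.ofReal (((1 - s) ^ 2 - (1 - t) ^ 2) / 2) *
        ENNReal.ofReal (2 * Real.pi * arcLength I) := by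
    rw [← lintegral_indicator_one hm, ← Complex.lintegral_comp_polarCoord_symm,
      ← volume_angle hI, ← lintegral_id_Ico (by linarith) (by linarith : 1 - t ≤ 1 - s)]
    have hB := (measurableSet_angle hI).inter (measurableSet_Ioo (a := -Real.pi) (b := Real.pi))
    rw [← setLIntegral_one ({θ | Circle.exp θ ∈ I} ∩ Ioo (-Real.pi) Real.pi),
      ← lintegral_prod_mul (by fun_prop) (by fun_prop), Measure.prod_restrict,
      ← lintegral_indicator (by
        rw [polarCoord_target]; exact measurableSet_Ioi.prod measurableSet_Ioo),
      ← lintegral_indicator (measurableSet_Ico.prod hB), Measure.volume_eq_prod]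
    refine lintegral_congr_ae ?_
    -- The polar chart omits `r = 0`, which the radial interval contains when `t = 1`.
    have h0 : ∀ᵐ x : ℝ × ℝ ∂(volume.prod volume), x.1 ≠ 0 := by
      have : (volume.prod volume : Measure (ℝ × ℝ)) ({0} ×ˢ univ) = 0 := by
        rw [Measure.prod_prod]; simp
      refine measure_mono_null ?_ this
      intro x hx
      simpa using hx
    filter_upwards [h0] with x hx0
    obtain ⟨r, θ⟩ := x
    simp only at hx0
    by_cases hr : 0 < r
    · by_cases hθ : θ ∈ Ioo (-Real.pi) Real.pi
      · have hz : Complex.polarCoord.symm (r, θ) ≠ 0 := by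
          rw [← norm_pos_iff, Complex.norm_polarCoord_symm]
          simpa using hr.ne'
        have harg : (Complex.polarCoord.symm (r, θ)).arg = θ := by
          rw [Complex.polarCoord_symm_apply]
          push_cast
          exact Complex.arg_mul_cos_add_sin_mul_I hr ⟨hθ.1, hθ.2.le⟩
        have hiff : Complex.polarCoord.symm (r, θ) ∈ shell I s t ↔
            (1 - t ≤ r ∧ r < 1 - s) ∧ Circle.exp θ ∈ I := by
          simp only [shell, mem_ofPred_eq, mem_sector_iff hz, harg, Complex.norm_polarCoord_symm,
            abs_of_pos hr]
          constructor
          · rintro ⟨⟨_, h1⟩, h2, h3⟩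
            exact ⟨⟨by linarith, by linarith⟩, h1⟩
          · rintro ⟨⟨h1, h2⟩, h3⟩
            exact ⟨⟨by linarith, h3⟩, by linarith, by linarith⟩
        rw [indicator_of_mem (by rw [polarCoord_target]; exact ⟨hr, hθ⟩)]
        by_cases h : Complex.polarCoord.symm (r, θ) ∈ shell I s t
        · have h' := hiff.1 h
          rw [indicator_of_mem h, indicator_of_mem]
          · simp
          · exact ⟨h'.1, h'.2, hθ⟩
        · rw [indicator_of_notMem h, indicator_of_notMem]
          · simp
          · exact fun hh => h (hiff.2 ⟨hh.1, hh.2.1⟩)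
      · rw [indicator_of_notMem, indicator_of_notMem]
        · exact fun h => hθ h.2.2
        · rw [polarCoord_target]
          exact fun h => hθ h.2
    · rw [indicator_of_notMem, indicator_of_notMem]
      · rintro ⟨⟨h1, h2⟩, -⟩
        simp only at h1 h2
        exact hr (lt_of_le_of_ne (by linarith) (Ne.symm hx0))
      · rw [polarCoord_target]
        exact fun h => hr h.1
  rw [area, Measure.smul_apply, Measure.restrict_apply hm, inter_eq_left.2 hsub, hvol, smul_eq_mul,
    ← ENNReal.ofReal_inv_of_pos hpi, ← ENNReal.ofReal_mul (by nlinarith),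
    ← ENNReal.ofReal_mul (by positivity)]
  congr 1
  field_simp

lemma area_sphere (r : ℝ) : area {z : ℂ | ‖z‖ = r} = 0 := by
  have h : volume {z : ℂ | ‖z‖ = r} = 0 := by
    have := Measure.addHaar_sphere (volume : Measure ℂ) 0 r
    convert this using 2
    ext z; simp
  rw [area, Measure.smul_apply, smul_eq_mul]
  rw [Measure.restrict_le_self.absolutelyContinuous h, mul_zero]

end Arcs

/-! ### The tree of grid arcs and the tiling of the disc. -/

section Grid

variable {D : Set (Set Circle)} {I J K : Set Circle}

lemma arcLength_univ : arcLength univ = 1 := by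
  rw [arcLength_eq (x := 0) (by simp [angleSet])]
  simp [angleSet]

namespace IsDyadicGrid

lemma measurableSet_angleSet (hD : IsDyadicGrid D) (hI : I ∈ D) : MeasurableSet (angleSet I) := by
  obtain ⟨a, l, -, -, rfl⟩ := hD.isArc I hI
  exact measurableSet_angleSet_arc a l

lemma arcLength_pos (hD : IsDyadicGrid D) (hI : I ∈ D) : 0 < arcLength I := by
  obtain ⟨n, hn⟩ := hD.dyadic I hI
  rw [hn]; positivity

lemma arcLength_le_one (hD : IsDyadicGrid D) (hI : I ∈ D) : arcLength I ≤ 1 := by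
  obtain ⟨n, hn⟩ := hD.dyadic I hI
  rw [hn]; exact pow_le_one₀ (by norm_num) (by norm_num)

lemma nonempty (hD : IsDyadicGrid D) (hI : I ∈ D) : I.Nonempty := by
  obtain ⟨a, l, hl, -, rfl⟩ := hD.isArc I hI
  exact ⟨_, mem_image_of_mem _ (right_mem_Ioc.2 (by linarith))⟩

lemma exists_halves (hD : IsDyadicGrid D) (hI : I ∈ D) :
    ∃ I₁ ∈ D, ∃ I₂ ∈ D, arcLength I₁ = arcLength I / 2 ∧ arcLength I₂ = arcLength I / 2 ∧
      Disjoint I₁ I₂ ∧ I = I₁ ∪ I₂ := by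
  obtain ⟨I₁, h₁, I₂, h₂, hl, hd, rfl⟩ := hD.halves I hI
  have := arcLength_union (hD.measurableSet_angleSet h₁) (hD.measurableSet_angleSet h₂) hd
  exact ⟨I₁, h₁, I₂, h₂, by linarith, by linarith, hd, rfl⟩

lemma eq_of_mem (hD : IsDyadicGrid D) (hI : I ∈ D) (hJ : J ∈ D) (h : arcLength I = arcLength J)
    {x : Circle} (hxI : x ∈ I) (hxJ : x ∈ J) : I = J := by
  obtain ⟨b, -, hb⟩ := (hD.partition J hJ).2 x
  exact (hb I ⟨⟨hI, h⟩, hxI⟩).trans (hb J ⟨⟨hJ, rfl⟩, hxJ⟩).symm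

lemma exists_subset_of_mem (hD : IsDyadicGrid D) (hJ : J ∈ D) {x : Circle} (hx : x ∈ J) (k : ℕ) :
    ∃ K ∈ D, K ⊆ J ∧ x ∈ K ∧ arcLength K = arcLength J * (1 / 2) ^ k := by
  induction k with
  | zero => exact ⟨J, hJ, subset_rfl, hx, by simp⟩
  | succ k ih =>
    obtain ⟨K, hK, hKJ, hxK, hl⟩ := ih
    obtain ⟨K₁, h₁, K₂, h₂, l₁, l₂, -, hu⟩ := hD.exists_halves hK
    rcases (hu ▸ hxK : x ∈ K₁ ∪ K₂) with h | h
    · exact ⟨K₁, h₁, (hu ▸ subset_union_left : K₁ ⊆ K).trans hKJ, h, by rw [l₁, hl]; ring⟩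
    · exact ⟨K₂, h₂, (hu ▸ subset_union_right : K₂ ⊆ K).trans hKJ, h, by rw [l₂, hl]; ring⟩

/-- Halving `J` repeatedly towards the common point reaches an arc of the length of `I`; the
partition property identifies it with `I`. Hence grid arcs that meet are nested. -/
lemma subset_of_mem (hD : IsDyadicGrid D) (hI : I ∈ D) (hJ : J ∈ D)
    (h : arcLength I ≤ arcLength J) {x : Circle} (hxI : x ∈ I) (hxJ : x ∈ J) : I ⊆ J := by
  obtain ⟨n, hn⟩ := hD.dyadic I hI
  obtain ⟨m, hm⟩ := hD.dyadic J hJ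
  have hmn : m ≤ n := by
    rw [hn, hm] at h
    exact (pow_le_pow_iff_right_of_lt_one₀ (by norm_num) (by norm_num)).1 h
  obtain ⟨K, hK, hKJ, hxK, hl⟩ := hD.exists_subset_of_mem hJ hxJ (n - m)
  have : I = K := hD.eq_of_mem hI hK
    (by rw [hl, hn, hm, ← pow_add, Nat.add_sub_cancel' hmn]) hxI hxK
  exact this ▸ hKJ

lemma arcLength_le_of_subset (hD : IsDyadicGrid D) (hI : I ∈ D) (hJ : J ∈ D) (h : I ⊆ J) :
    arcLength I ≤ arcLength J := by
  rw [arcLength_eq (hD.measurableSet_angleSet hI) 0, arcLength_eq (hD.measurableSet_angleSet hJ) 0]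
  refine ENNReal.toReal_mono ((measure_mono inter_subset_right).trans_lt (by simp) |>.ne)
    (measure_mono (inter_subset_inter_left _ fun t ht => h ht))

lemma exists_arcLength_eq (hD : IsDyadicGrid D) (hK : K ∈ D) (hJ : J ∈ D) (h : K ⊆ J) :
    ∃ k : ℕ, arcLength K = arcLength J * (1 / 2) ^ k := by
  obtain ⟨n, hn⟩ := hD.dyadic K hK
  obtain ⟨m, hm⟩ := hD.dyadic J hJ
  have hmn : m ≤ n := by
    have := hD.arcLength_le_of_subset hK hJ h
    rw [hn, hm] at this
    exact (pow_le_pow_iff_right_of_lt_one₀ (by norm_num) (by norm_num)).1 this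
  exact ⟨n - m, by rw [hn, hm, ← pow_add, Nat.add_sub_cancel' hmn]⟩

/-- Descending induction along the chain of the grid arcs between `K` and `J`. -/
lemma exists_half_between (hD : IsDyadicGrid D) (hK : K ∈ D) (hJ : J ∈ D) (h : K ⊆ J) {k : ℕ}
    (hl : arcLength K = arcLength J * (1 / 2) ^ (k + 1)) :
    ∃ Q ∈ D, K ⊆ Q ∧ Q ⊆ J ∧ arcLength Q = arcLength J / 2 := by
  obtain ⟨x, hx⟩ := hD.nonempty hK
  obtain ⟨Q, hQ, hQJ, hxQ, hlQ⟩ := hD.exists_subset_of_mem hJ (h hx) 1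
  refine ⟨Q, hQ, hD.subset_of_mem hK hQ ?_ hx hxQ, hQJ, by rw [hlQ]; ring⟩
  rw [hl, hlQ]
  exact mul_le_mul_of_nonneg_left
    (pow_le_pow_of_le_one (by norm_num) (by norm_num) (by omega)) (arcLength_nonneg _)

lemma topHalf_eq (hD : IsDyadicGrid D) (hI : I ∈ D) :
    topHalf I = shell I (arcLength I / 2) (arcLength I) := by
  have := hD.arcLength_pos hI
  ext z
  simp only [topHalf, shell, mem_ofPred_eq, lt_div_iff₀ this, div_le_one this]
  rw [one_div_mul_eq_div]

lemma eq_of_mem_topHalf (hD : IsDyadicGrid D) (hI : I ∈ D) (hJ : J ∈ D) {z : ℂ}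
    (hzI : z ∈ topHalf I) (hzJ : z ∈ topHalf J) : I = J := by
  have hl : arcLength I = arcLength J := by
    rw [hD.topHalf_eq hI] at hzI
    rw [hD.topHalf_eq hJ] at hzJ
    obtain ⟨n, hn⟩ := hD.dyadic I hI
    obtain ⟨m, hm⟩ := hD.dyadic J hJ
    obtain ⟨-, h1, h2⟩ := hzI
    obtain ⟨-, h3, h4⟩ := hzJ
    -- The intervals `(2⁻ⁿ / 2, 2⁻ⁿ]` are disjoint for different `n`, so `1 - ‖z‖` determines the
    -- generation.
    have key : ∀ a b : ℕ, (1 / 2 : ℝ) ^ a / 2 < (1 / 2) ^ b → b ≤ a := by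
      intro a b h
      have h' : (1 / 2 : ℝ) ^ (a + 1) < (1 / 2) ^ b := by rw [pow_succ]; linarith
      have := (pow_lt_pow_iff_right_of_lt_one₀ (by norm_num) (by norm_num)).1 h'
      omega
    rw [hn] at h1 h2 ⊢
    rw [hm] at h3 h4 ⊢
    rw [le_antisymm (key m n (h3.trans_le h2)) (key n m (h1.trans_le h4))]
  -- The origin has no direction to tell arcs apart, but its height 1 forces the arc to be the whole
  -- circle.
  by_cases hz : z = 0
  · have key : ∀ L ∈ D, z ∈ topHalf L → L = univ := by
      intro L hL hzL
      rw [hD.topHalf_eq hL] at hzL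
      obtain ⟨-, -, h⟩ := hzL
      rw [hz, norm_zero, sub_zero] at h
      obtain ⟨x, hx⟩ := hD.nonempty hL
      exact hD.eq_of_mem hL hD.univ_mem
        (by rw [arcLength_univ]; exact le_antisymm (hD.arcLength_le_one hL) h) hx (mem_univ x)
    rw [key I hI hzI, key J hJ hzJ]
  · exact hD.eq_of_mem hI hJ hl ((mem_sector_iff hz).1 hzI.1).2 ((mem_sector_iff hz).1 hzJ.1).2

lemma exists_mem_topHalf (hD : IsDyadicGrid D) {z : ℂ} (hz : z ∈ disc) :
    ∃ I ∈ D, z ∈ topHalf I := by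
  have h1 : ‖z‖ < 1 := by simpa [disc] using hz
  obtain ⟨n, hn1, hn2⟩ := exists_nat_pow_near_of_lt_one (y := (1 / 2 : ℝ)) (x := 1 - ‖z‖)
    (by linarith) (by simp) (by norm_num) (by norm_num)
  obtain ⟨K, hK, -, hxK, hlK⟩ := hD.exists_subset_of_mem hD.univ_mem (mem_univ (Circle.exp z.arg)) n
  refine ⟨K, hK, ?_⟩
  rw [arcLength_univ, one_mul] at hlK
  rw [hD.topHalf_eq hK, hlK]
  refine ⟨⟨hz, _, hxK, ?_⟩, by rw [pow_succ] at hn1; linarith, hn2⟩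
  rw [Circle.coe_exp, Complex.norm_mul_exp_arg_mul_I]

lemma gridArc_eq (hD : IsDyadicGrid D) (hI : I ∈ D) {z : ℂ} (hz : z ∈ topHalf I) :
    gridArc D z = I := by
  have : {J | J ∈ D ∧ z ∈ topHalf J} = {I} := by
    ext J
    simp only [mem_ofPred_eq, mem_singleton_iff]
    exact ⟨fun h => hD.eq_of_mem_topHalf h.1 hI h.2 hz, fun h => h ▸ ⟨hI, hz⟩⟩
  rw [gridArc, this, sUnion_singleton]

lemma disc_eq (hD : IsDyadicGrid D) : disc = ⋃ I ∈ D, topHalf I := by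
  ext z
  simp only [mem_iUnion, exists_prop]
  exact ⟨hD.exists_mem_topHalf, fun ⟨I, _, h⟩ => h.1.1⟩

/-- Arcs of one length have disjoint parameter sets, each containing an open interval. Countability
allows almost-everywhere statements to be checked tile by tile. -/
lemma countable (hD : IsDyadicGrid D) : D.Countable := by
  have h1 : D = ⋃ n : ℕ, {I | I ∈ D ∧ arcLength I = (1 / 2 : ℝ) ^ n} := by
    ext I
    simp only [mem_iUnion, mem_ofPred_eq]
    exact ⟨fun h => (hD.dyadic I h).imp fun n hn => ⟨h, hn⟩, fun ⟨_, h, _⟩ => h⟩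
  rw [h1]
  refine countable_iUnion fun n => ?_
  refine Set.PairwiseDisjoint.countable_of_nonempty_interior (s := angleSet) ?_ ?_
  · intro I hI J hJ hne
    refine Set.disjoint_left.2 fun t htI htJ => hne ?_
    exact hD.eq_of_mem hI.1 hJ.1 (hI.2.trans hJ.2.symm) htI htJ
  · rintro I ⟨hI, -⟩
    obtain ⟨a, l, hl, -, rfl⟩ := hD.isArc I hI
    have : Ioo a (a + l) ⊆ angleSet (arc a l) := fun t ht =>
      mem_image_of_mem _ (Ioo_subset_Ioc_self ht)
    exact (nonempty_Ioo.2 (by linarith)).mono (interior_maximal this isOpen_Ioo)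

/-- Take a common ancestor with the largest exponent, which is bounded by that of `I`. By nestedness
it lies in all the others, so it equals their intersection. -/
lemma commonArc_spec (hD : IsDyadicGrid D) (hI : I ∈ D) (J : Set Circle) :
    commonArc D I J ∈ D ∧ I ⊆ commonArc D I J ∧ J ⊆ commonArc D I J := by
  let s : Set ℕ := {n | ∃ K ∈ D, I ⊆ K ∧ J ⊆ K ∧ arcLength K = (1 / 2 : ℝ) ^ n}
  obtain ⟨N, hN⟩ := hD.dyadic I hI
  have hb : BddAbove s := by
    refine ⟨N, ?_⟩
    rintro n ⟨K, hK, hIK, -, hl⟩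
    have := hD.arcLength_le_of_subset hI hK hIK
    rw [hN, hl] at this
    exact (pow_le_pow_iff_right_of_lt_one₀ (by norm_num) (by norm_num)).1 this
  have hs : s.Nonempty := ⟨0, univ, hD.univ_mem, subset_univ _, subset_univ _, by
    simp [arcLength_univ]⟩
  obtain ⟨P, hP, hIP, hJP, hlP⟩ := Nat.sSup_mem hs hb
  have : commonArc D I J = P := by
    refine subset_antisymm (sInter_subset_of_mem ⟨hP, hIP, hJP⟩) (subset_sInter ?_)
    rintro K ⟨hK, hIK, hJK⟩
    obtain ⟨x, hx⟩ := hD.nonempty hI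
    obtain ⟨n, hn⟩ := hD.dyadic K hK
    refine hD.subset_of_mem hP hK ?_ (hIP hx) (hIK hx)
    rw [hlP, hn]
    exact pow_le_pow_of_le_one (by norm_num) (by norm_num) (le_csSup hb ⟨K, hK, hIK, hJK, hn⟩)
  rw [this]
  exact ⟨hP, hIP, hJP⟩

lemma dyadicDist_eq_zero (hD : IsDyadicGrid D) (hI : I ∈ D) {z ζ : ℂ} (hz : z ∈ topHalf I)
    (hζ : ζ ∈ topHalf I) : dyadicDist D z ζ = 0 := by
  have h : commonArc D I I = I :=
    subset_antisymm (sInter_subset_of_mem ⟨hI, subset_rfl, subset_rfl⟩)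
      (hD.commonArc_spec hI I).2.1
  rw [dyadicDist, hD.gridArc_eq hI hz, hD.gridArc_eq hI hζ, h, min_self,
    div_self (hD.arcLength_pos hI).ne', Real.logb_one]

/-- A function on the grid whose jump from an arc to its halves is bounded by `c` grows at most
linearly in the dyadic distance. -/
lemma abs_sub_le_of_subset (hD : IsDyadicGrid D) {g : Set Circle → ℝ} {c : ℝ}
    (hg : ∀ Q ∈ D, ∀ P ∈ D, Q ⊆ P → arcLength Q = arcLength P / 2 → |g Q - g P| ≤ c) (k : ℕ)
    (hK : K ∈ D) (hJ : J ∈ D) (h : K ⊆ J) (hl : arcLength K = arcLength J * (1 / 2) ^ k) :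
    |g K - g J| ≤ c * k := by
  induction k generalizing J with
  | zero =>
    obtain ⟨x, hx⟩ := hD.nonempty hK
    have : K = J := hD.eq_of_mem hK hJ (by simpa using hl) hx (h hx)
    simp [this]
  | succ k ih =>
    obtain ⟨Q, hQ, hKQ, hQJ, hlQ⟩ := hD.exists_half_between hK hJ h hl
    have h1 := ih hQ hKQ (by rw [hl, hlQ]; ring)
    have h2 := hg Q hQ J hJ hQJ hlQ
    have h3 := abs_sub_le (g K) (g Q) (g J)
    push_cast
    linarith

/-- Climb from `I` to the common ancestor and descend to `J`: each leg has at most `dyadicDist D z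
ζ` steps, whence the factor 2. -/
lemma abs_sub_le_dyadicDist (hD : IsDyadicGrid D) {g : Set Circle → ℝ} {c : ℝ} (hc : 0 ≤ c)
    (hg : ∀ Q ∈ D, ∀ P ∈ D, Q ⊆ P → arcLength Q = arcLength P / 2 → |g Q - g P| ≤ c)
    {z ζ : ℂ} (hI : I ∈ D) (hJ : J ∈ D) (hz : z ∈ topHalf I) (hζ : ζ ∈ topHalf J) :
    0 ≤ dyadicDist D z ζ ∧ |g I - g J| ≤ 2 * c * dyadicDist D z ζ := by
  obtain ⟨hP, hIP, hJP⟩ := hD.commonArc_spec hI J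
  rw [dyadicDist, hD.gridArc_eq hI hz, hD.gridArc_eq hJ hζ]
  set P := commonArc D I J
  set m := min (arcLength I) (arcLength J) with hm
  have hmpos : 0 < m := lt_min (hD.arcLength_pos hI) (hD.arcLength_pos hJ)
  have hPpos := hD.arcLength_pos hP
  have key : ∀ L ∈ D, L ⊆ P → m ≤ arcLength L →
      |g L - g P| ≤ c * Real.logb 2 (arcLength P / m) := by
    intro L hL hLP hmL
    obtain ⟨k, hk⟩ := hD.exists_arcLength_eq hL hP hLP
    refine (hD.abs_sub_le_of_subset hg k hL hP hLP hk).trans (mul_le_mul_of_nonneg_left ?_ hc)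
    rw [Real.le_logb_iff_rpow_le one_lt_two (by positivity), Real.rpow_natCast, le_div_iff₀ hmpos]
    calc (2 : ℝ) ^ k * m ≤ 2 ^ k * (arcLength P * (1 / 2) ^ k) := by rw [← hk]; gcongr
      _ = arcLength P * (2 * (1 / 2)) ^ k := by rw [mul_pow]; ring
      _ = arcLength P := by norm_num
  refine ⟨Real.logb_nonneg one_lt_two ?_, ?_⟩
  · rw [one_le_div hmpos]
    exact (min_le_left _ _).trans (hD.arcLength_le_of_subset hI hP hIP)
  · have h1 := key I hI hIP (min_le_left _ _)
    have h2 := key J hJ hJP (min_le_right _ _)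
    have h3 := abs_sub_le (g I) (g P) (g J)
    rw [abs_sub_comm (g P)] at h3
    linarith

end IsDyadicGrid

/-! ### Carleson squares, their layers of tiles, and their areas. -/

/-- The Carleson square with its inner boundary arc added. -/
def box (I : Set Circle) : Set ℂ := shell I 0 (arcLength I)

/-- The union of the first `n` layers of tiles of `box I`. -/
def layers (n : ℕ) (I : Set Circle) : Set ℂ := shell I (arcLength I / 2 ^ n) (arcLength I)

/-- The two differ only on a circle, which is null. The version `box` is the one that layers of
tiles exhaust exactly. -/
lemma carlesonSquare_ae_eq (I : Set Circle) : carlesonSquare I =ᵐ[area] box I := by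
  have : ∀ᵐ z ∂area, ‖z‖ ≠ 1 - arcLength I := by
    rw [ae_iff]; simpa using area_sphere (1 - arcLength I)
  filter_upwards [this] with z hz
  refine propext ⟨fun h => ⟨h.1, ?_, h.2.le⟩, fun h => ⟨h.1, lt_of_le_of_ne h.2.2 ?_⟩⟩
  · have : ‖z‖ < 1 := by simpa [disc] using h.1.1
    linarith
  · intro hh; exact hz (by linarith)

lemma carlesonSquare_ae_eq_restrict (I : Set Circle) (Ω : Set ℂ) :
    area.restrict (carlesonSquare I ∩ Ω) = area.restrict (box I ∩ Ω) :=
  Measure.restrict_congr_set ((carlesonSquare_ae_eq I).inter (Filter.EventuallyEq.refl _ _))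

lemma iUnion_layers (I : Set Circle) : ⋃ n, layers n I = box I := by
  ext z
  simp only [layers, box, shell, mem_iUnion, mem_ofPred_eq]
  constructor
  · rintro ⟨n, h1, h2, h3⟩
    refine ⟨h1, lt_of_le_of_lt ?_ h2, h3⟩
    have := arcLength_nonneg I
    positivity
  · rintro ⟨h1, h2, h3⟩
    obtain ⟨n, hn⟩ := exists_pow_lt_of_lt_one h2 (by norm_num : (1 / 2 : ℝ) < 1)
    refine ⟨n, h1, lt_of_le_of_lt ?_ hn, h3⟩
    have hl : arcLength I ≤ 1 := by
      have : volume {t : ℝ | t ∈ Ioc (0 : ℝ) 1 ∧ Circle.exp (2 * Real.pi * t) ∈ I} ≤ 1 :=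
        (measure_mono (fun t ht => ht.1)).trans_eq (by simp : volume (Ioc (0 : ℝ) 1) = 1)
      exact ENNReal.toReal_mono (by simp) this
    rw [one_div, inv_pow, div_eq_mul_inv]
    exact mul_le_of_le_one_left (by positivity) hl

lemma monotone_layers (I : Set Circle) : Monotone fun n => layers n I := by
  intro m n hmn z hz
  refine ⟨hz.1, lt_of_le_of_lt ?_ hz.2.1, hz.2.2⟩
  have := arcLength_nonneg I
  gcongr
  norm_num

lemma sector_union (I J : Set Circle) : sector (I ∪ J) = sector I ∪ sector J := by
  ext z
  simp only [sector, mem_ofPred_eq, mem_union]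
  constructor
  · rintro ⟨h, ζ, h1 | h1, h2⟩
    · exact Or.inl ⟨h, ζ, h1, h2⟩
    · exact Or.inr ⟨h, ζ, h1, h2⟩
  · rintro (⟨h, ζ, h1, h2⟩ | ⟨h, ζ, h1, h2⟩)
    · exact ⟨h, ζ, Or.inl h1, h2⟩
    · exact ⟨h, ζ, Or.inr h1, h2⟩

lemma layers_zero (I : Set Circle) : layers 0 I = ∅ := by
  ext z
  simp only [layers, shell, pow_zero, div_one, mem_ofPred_eq, mem_empty_iff_false, iff_false]
  rintro ⟨-, h1, h2⟩
  linarith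

lemma layers_succ_subset {I I₁ I₂ : Set Circle} (h₁ : arcLength I₁ = arcLength I / 2)
    (h₂ : arcLength I₂ = arcLength I / 2) (hu : I = I₁ ∪ I₂) (n : ℕ) :
    layers (n + 1) I ⊆ shell I (arcLength I / 2) (arcLength I) ∪ (layers n I₁ ∪ layers n I₂) := by
  rintro z ⟨h, h1, h2⟩
  by_cases hz : arcLength I / 2 < 1 - ‖z‖
  · exact Or.inl ⟨h, hz, h2⟩
  · right
    have h3 : arcLength I / 2 ^ (n + 1) = arcLength I / 2 / 2 ^ n := by rw [pow_succ']; field_simp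
    rw [hu, sector_union] at h
    rw [h3] at h1
    rcases h with h | h
    · exact Or.inl ⟨h, by rwa [h₁], by rw [h₁]; linarith⟩
    · exact Or.inr ⟨h, by rwa [h₂], by rw [h₂]; linarith⟩

/-- The condition `t < 1` keeps out the origin, which sectors over disjoint arcs may share. -/
lemma disjoint_shell {I J : Set Circle} (h : Disjoint I J) {s t u : ℝ} (ht : t < 1) :
    Disjoint (shell I s t) (shell J u t) := by
  refine Set.disjoint_left.2 fun z h1 h2 => ?_
  have hz : z ≠ 0 := by
    rintro rfl
    have := h1.2.2
    rw [norm_zero] at this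
    linarith
  exact Set.disjoint_left.1 h ((mem_sector_iff hz).1 h1.1).2 ((mem_sector_iff hz).1 h2.1).2

section Lintegral

variable {I₁ I₂ : Set Circle}

/-- The recursion behind both inductions on generations: the top tile, then one layer fewer over
each half. Subadditivity suffices, so `f` may be arbitrary. -/
lemma lintegral_layers_succ_le (h₁ : arcLength I₁ = arcLength I / 2)
    (h₂ : arcLength I₂ = arcLength I / 2) (hu : I = I₁ ∪ I₂) (n : ℕ) (f : ℂ → ℝ≥0∞) :
    ∫⁻ z in layers (n + 1) I, f z ∂area ≤
      ∫⁻ z in shell I (arcLength I / 2) (arcLength I), f z ∂area +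
        (∫⁻ z in layers n I₁, f z ∂area + ∫⁻ z in layers n I₂, f z ∂area) :=
  (lintegral_mono_set (layers_succ_subset h₁ h₂ hu n)).trans <|
    (lintegral_union_le _ _ _).trans <| add_le_add le_rfl (lintegral_union_le _ _ _)

lemma IsDyadicGrid.lintegral_box_ge (hD : IsDyadicGrid D) (hI : I ∈ D) (hI₁ : I₁ ∈ D)
    (hI₂ : I₂ ∈ D) (h₁ : arcLength I₁ = arcLength I / 2)
    (h₂ : arcLength I₂ = arcLength I / 2) (hd : Disjoint I₁ I₂) (hu : I = I₁ ∪ I₂)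
    (f : ℂ → ℝ≥0∞) :
    ∫⁻ z in topHalf I, f z ∂area + (∫⁻ z in box I₁, f z ∂area + ∫⁻ z in box I₂, f z ∂area) ≤
      ∫⁻ z in box I, f z ∂area := by
  have hl := hD.arcLength_pos hI
  have hl1 := hD.arcLength_le_one hI
  have m1 : MeasurableSet (box I₁) := measurableSet_shell (hD.measurableSet_angleSet hI₁) _ _
  have m2 : MeasurableSet (box I₂) := measurableSet_shell (hD.measurableSet_angleSet hI₂) _ _
  have hd12 : Disjoint (box I₁) (box I₂) := by
    rw [box, box, h₁, h₂]
    exact disjoint_shell hd (by linarith)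
  rw [← lintegral_union m2 hd12, ← lintegral_union (m1.union m2), hD.topHalf_eq hI]
  · refine lintegral_mono_set ?_
    rintro z (h | h | h)
    · exact ⟨h.1, by linarith [h.2.1], h.2.2⟩
    · exact ⟨by rw [hu, sector_union]; exact Or.inl h.1, h.2.1, by linarith [h.2.2]⟩
    · exact ⟨by rw [hu, sector_union]; exact Or.inr h.1, h.2.1, by linarith [h.2.2]⟩
  · rw [hD.topHalf_eq hI]
    refine Set.disjoint_left.2 ?_
    rintro z h (h' | h')
    · linarith [h.2.1, h'.2.2]
    · linarith [h.2.1, h'.2.2]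

lemma lintegral_box_le {B : ℝ≥0∞} (f : ℂ → ℝ≥0∞)
    (h : ∀ n, ∫⁻ z in layers n I, f z ∂area ≤ B) : ∫⁻ z in box I, f z ∂area ≤ B := by
  rw [← iUnion_layers, setLIntegral_iUnion_of_directed f (monotone_layers I).directed_le]
  exact iSup_le h

end Lintegral

/-- The area of the Carleson square over `I`. -/
noncomputable def boxArea (I : Set Circle) : ℝ := arcLength I ^ 2 * (2 - arcLength I)

/-- The area of the top half over `I`. -/
noncomputable def tileArea (I : Set Circle) : ℝ := arcLength I ^ 2 * (1 - 3 / 4 * arcLength I)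

/-- An exact identity, so that the induction for Kolmogorov's inequality loses nothing from one
generation to the next. -/
lemma tileArea_add {I I₁ I₂ : Set Circle} (h₁ : arcLength I₁ = arcLength I / 2)
    (h₂ : arcLength I₂ = arcLength I / 2) :
    tileArea I + (boxArea I₁ + boxArea I₂) = boxArea I := by
  rw [tileArea, boxArea, boxArea, boxArea, h₁, h₂]; ring

namespace IsDyadicGrid

lemma area_box (hD : IsDyadicGrid D) (hI : I ∈ D) : area (box I) = ENNReal.ofReal (boxArea I) := by
  rw [box, area_shell (hD.measurableSet_angleSet hI) le_rfl (arcLength_nonneg I)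
    (hD.arcLength_le_one hI), boxArea]
  congr 1; ring

lemma area_carlesonSquare (hD : IsDyadicGrid D) (hI : I ∈ D) :
    area (carlesonSquare I) = ENNReal.ofReal (boxArea I) := by
  rw [measure_congr (carlesonSquare_ae_eq I), hD.area_box hI]

lemma boxArea_pos (hD : IsDyadicGrid D) (hI : I ∈ D) : 0 < boxArea I := by
  have := hD.arcLength_pos hI
  have := hD.arcLength_le_one hI
  exact mul_pos (by positivity) (by linarith)

lemma boxArea_le (hD : IsDyadicGrid D) (hI : I ∈ D) (h : arcLength J = arcLength I / 2) :
    boxArea I ≤ 4 * boxArea J := by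
  have := hD.arcLength_pos hI
  rw [boxArea, boxArea, h]
  nlinarith [pow_pos this 3]

lemma area_topHalf (hD : IsDyadicGrid D) (hI : I ∈ D) :
    area (topHalf I) = ENNReal.ofReal (tileArea I) := by
  have h0 := hD.arcLength_pos hI
  rw [hD.topHalf_eq hI, area_shell (hD.measurableSet_angleSet hI) (by linarith) (by linarith)
    (hD.arcLength_le_one hI), tileArea]
  congr 1; ring

/-- After division by the squared length this reads `2 - x ≤ 4 - 3 x`, with equality for the whole
circle. -/
lemma boxArea_le_tileArea (hD : IsDyadicGrid D) (hI : I ∈ D) : boxArea I ≤ 4 * tileArea I := by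
  have h0 := hD.arcLength_pos hI
  rw [boxArea, tileArea]
  nlinarith [mul_nonneg (pow_pos h0 2).le (sub_nonneg.2 (hD.arcLength_le_one hI))]

lemma tileArea_pos (hD : IsDyadicGrid D) (hI : I ∈ D) : 0 < tileArea I := by
  linarith [hD.boxArea_le_tileArea hI, hD.boxArea_pos hI]

lemma measurableSet_topHalf (hD : IsDyadicGrid D) (hI : I ∈ D) : MeasurableSet (topHalf I) :=
  hD.topHalf_eq hI ▸ measurableSet_shell (hD.measurableSet_angleSet hI) _ _

end IsDyadicGrid

lemma area_disc : area disc = 1 := by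
  have hpi := Real.pi_pos
  rw [area, Measure.smul_apply, Measure.restrict_apply_self, disc, Complex.volume_ball]
  simp only [ENNReal.ofReal_one, one_pow, one_mul, smul_eq_mul]
  rw [← NNReal.coe_real_pi, ENNReal.ofReal_coe_nnreal, ENNReal.inv_mul_cancel]
  · simpa using NNReal.pi_ne_zero
  · simp

instance : IsFiniteMeasure area := by
  constructor
  have : area disc = area (univ : Set ℂ) := by
    rw [area, Measure.smul_apply, Measure.smul_apply, Measure.restrict_apply_self,
      Measure.restrict_apply_univ]
  rw [← this, area_disc]
  simp

end Grid

/-! ### Masses and averages over Carleson squares. -/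

section TreeInequalities

variable {D : Set (Set Circle)} {I J K : Set Circle}

/-- A function whose logarithm oscillates by at most `L` is, together with its powers, comparable
to its average. -/
lemma ae_rpow_mul_measure_le {α : Type*} [MeasurableSpace α] {μ : Measure α} {w : α → ℝ} {L : ℝ}
    (hpos : ∀ᵐ z ∂μ, 0 < w z)
    (hosc : ∀ᵐ z ∂μ, ∀ᵐ ζ ∂μ, |Real.log (w z) - Real.log (w ζ)| ≤ L) (e : ℝ) :
    ∀ᵐ z ∂μ, ENNReal.ofReal (w z) ^ e * μ univ ≤
      ENNReal.ofReal (Real.exp (L * |e|)) * ∫⁻ ζ, ENNReal.ofReal (w ζ) ^ e ∂μ := by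
  filter_upwards [hpos, hosc] with z hz hzosc
  rw [← lintegral_const, ← lintegral_const_mul' _ _ ENNReal.ofReal_ne_top]
  refine lintegral_mono_ae ?_
  filter_upwards [hpos, hzosc] with ζ hζ h
  rw [ENNReal.ofReal_rpow_of_pos hz, ENNReal.ofReal_rpow_of_pos hζ,
    ← ENNReal.ofReal_mul (Real.exp_pos _).le]
  refine ENNReal.ofReal_le_ofReal ?_
  rw [Real.rpow_def_of_pos hz, Real.rpow_def_of_pos hζ, ← Real.exp_add, Real.exp_le_exp]
  have h1 : (Real.log (w z) - Real.log (w ζ)) * e ≤ L * |e| :=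
    (le_abs_self _).trans (by rw [abs_mul]; gcongr)
  linarith

/-- The integral of `f` over the Carleson square over `I`, as a real number. -/
noncomputable def mass (f : ℂ → ℝ≥0∞) (I : Set Circle) : ℝ := (∫⁻ z in box I, f z ∂area).toReal

/-- The average of `f` over the Carleson square over `I`. -/
noncomputable def avg (f : ℂ → ℝ≥0∞) (I : Set Circle) : ℝ := mass f I / boxArea I

section Mass

variable {f : ℂ → ℝ≥0∞} {I₁ I₂ : Set Circle}

lemma mass_nonneg (f : ℂ → ℝ≥0∞) (I : Set Circle) : 0 ≤ mass f I := ENNReal.toReal_nonneg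

lemma setLIntegral_ne_top (hf : ∫⁻ z, f z ∂area ≠ ∞) (s : Set ℂ) : ∫⁻ z in s, f z ∂area ≠ ∞ :=
  ((setLIntegral_le_lintegral _ _).trans_lt hf.lt_top).ne

lemma ofReal_mass (hf : ∫⁻ z, f z ∂area ≠ ∞) (I : Set Circle) :
    ENNReal.ofReal (mass f I) = ∫⁻ z in box I, f z ∂area :=
  ENNReal.ofReal_toReal (setLIntegral_ne_top hf _)

namespace IsDyadicGrid

lemma avg_nonneg (hD : IsDyadicGrid D) (hI : I ∈ D) (f : ℂ → ℝ≥0∞) : 0 ≤ avg f I :=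
  div_nonneg (mass_nonneg f I) (hD.boxArea_pos hI).le

lemma avg_mul_boxArea (hD : IsDyadicGrid D) (hI : I ∈ D) (f : ℂ → ℝ≥0∞) :
    avg f I * boxArea I = mass f I := div_mul_cancel₀ _ (hD.boxArea_pos hI).ne'

lemma mass_add_le (hD : IsDyadicGrid D) (hf : ∫⁻ z, f z ∂area ≠ ∞) (hI : I ∈ D) (hI₁ : I₁ ∈ D)
    (hI₂ : I₂ ∈ D) (h₁ : arcLength I₁ = arcLength I / 2)
    (h₂ : arcLength I₂ = arcLength I / 2) (hd : Disjoint I₁ I₂) (hu : I = I₁ ∪ I₂) :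
    (∫⁻ z in topHalf I, f z ∂area).toReal + (mass f I₁ + mass f I₂) ≤ mass f I := by
  have h := ENNReal.toReal_mono (setLIntegral_ne_top hf _)
    (hD.lintegral_box_ge hI hI₁ hI₂ h₁ h₂ hd hu f)
  have n := setLIntegral_ne_top hf
  rwa [ENNReal.toReal_add (n _) (ENNReal.add_ne_top.2 ⟨n _, n _⟩), ENNReal.toReal_add (n _) (n _)]
    at h

lemma avg_le_of_half (hD : IsDyadicGrid D) (hf : ∫⁻ z, f z ∂area ≠ ∞) (hI : I ∈ D) (hJ : J ∈ D)
    (hJI : J ⊆ I) (hl : arcLength J = arcLength I / 2) : avg f J ≤ 4 * avg f I := by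
  have h1 : mass f J ≤ mass f I := by
    refine ENNReal.toReal_mono (setLIntegral_ne_top hf _) (lintegral_mono_set ?_)
    rintro z ⟨⟨h, x, hx, h'⟩, h2, h3⟩
    exact ⟨⟨h, x, hJI hx, h'⟩, h2, by linarith [hD.arcLength_pos hI]⟩
  have h2 := hD.boxArea_pos hI
  have h3 := hD.boxArea_pos hJ
  rw [avg, avg, div_le_iff₀ h3]
  calc mass f J ≤ mass f I := h1
    _ = mass f I / boxArea I * boxArea I := by field_simp
    _ ≤ mass f I / boxArea I * (4 * boxArea J) := by
      have := mass_nonneg f I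
      gcongr
      exact hD.boxArea_le hI hl
    _ = _ := by ring

/-- On a tile, the average over the Carleson square dominates the average over the tile. -/
lemma lintegral_topHalf_le (hD : IsDyadicGrid D) (hf : ∫⁻ z, f z ∂area ≠ ∞) (hI : I ∈ D) :
    ∫⁻ z in topHalf I, f z ∂area ≤ ENNReal.ofReal (4 * avg f I) * area (topHalf I) := by
  have h1 : topHalf I ⊆ box I := by
    rw [hD.topHalf_eq hI]
    exact fun z hz => ⟨hz.1, by linarith [hz.2.1, hD.arcLength_pos hI], hz.2.2⟩
  refine (lintegral_mono_set h1).trans ?_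
  have := hD.avg_nonneg hI f
  rw [← ofReal_mass hf, hD.area_topHalf hI, ← ENNReal.ofReal_mul (by positivity),
    ← hD.avg_mul_boxArea hI]
  refine ENNReal.ofReal_le_ofReal ?_
  nlinarith [hD.boxArea_le_tileArea hI]

end IsDyadicGrid

end Mass

/-! ### Kolmogorov's inequality on the tree. -/

section Kolmogorov

/-- The right side is the tangent at `m` to the concave function `y ^ δ`. -/
lemma rpow_le_linear {δ m y : ℝ} (h0 : 0 < δ) (h1 : δ < 1) (hm : 0 < m) (hy : 0 < y) :
    y ^ δ ≤ (1 - δ) * m ^ δ + δ * (m ^ (δ - 1) * y) := by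
  have h := Real.geom_mean_le_arith_mean2_weighted (by linarith : 0 ≤ 1 - δ) h0.le hm.le hy.le
    (by ring)
  have h2 := mul_le_mul_of_nonneg_left h (Real.rpow_pos_of_pos hm (δ - 1)).le
  have e1 : m ^ (δ - 1) * m ^ (1 - δ) = 1 := by
    rw [← Real.rpow_add hm]; simp
  have e2 : m ^ (δ - 1) * m = m ^ δ := by
    rw [← Real.rpow_add_one hm.ne']; simp
  rw [← mul_assoc, e1, one_mul] at h2
  calc y ^ δ ≤ _ := h2
    _ = (1 - δ) * (m ^ (δ - 1) * m) + δ * (m ^ (δ - 1) * y) := by ring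
    _ = _ := by rw [e2]

/-- As a function of `m`, the right side has derivative `δ m ^ (δ - 2) (m a - F)`, so it decreases
while `m ≤ F / a`; the factor `δ / (1 - δ)` is chosen for this. Raising `m` towards the average `F /
a` therefore costs nothing. -/
lemma kolmogorov_step {δ m y a F : ℝ} (h0 : 0 < δ) (h1 : δ < 1) (hm : 0 < m) (ha : 0 < a)
    (hy : y ≤ max m (F / a)) :
    (max m y) ^ δ * a + δ / (1 - δ) * (max m y) ^ (δ - 1) * F ≤
      m ^ δ * a + δ / (1 - δ) * m ^ (δ - 1) * F := by
  rcases le_or_gt y m with h | h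
  · rw [max_eq_left h]
  · rw [max_eq_right h.le]
    have hyF : y ≤ F / a := by
      rcases le_max_iff.1 hy with h' | h'
      · linarith
      · exact h'
    rw [le_div_iff₀ ha] at hyF
    have hypos := hm.trans h
    have hmono : y ^ (δ - 1) ≤ m ^ (δ - 1) :=
      Real.rpow_le_rpow_of_nonpos hm h.le (by linarith)
    have e : y ^ (δ - 1) * y = y ^ δ := by
      rw [← Real.rpow_add_one hypos.ne']; simp
    have h2 := rpow_le_linear h0 h1 hm hypos
    have h3 : (m ^ (δ - 1) - y ^ (δ - 1)) * (y * a) ≤ (m ^ (δ - 1) - y ^ (δ - 1)) * F :=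
      mul_le_mul_of_nonneg_left hyF (sub_nonneg.2 hmono)
    have h4 : 0 < 1 - δ := by linarith
    have h5 : y ^ δ - m ^ δ ≤ δ / (1 - δ) * (m ^ (δ - 1) * y - y ^ δ) := by
      rw [div_mul_eq_mul_div, le_div_iff₀ h4]
      linarith
    have h6 := mul_le_mul_of_nonneg_right h5 ha.le
    have h7 := mul_le_mul_of_nonneg_left h3 (div_nonneg h0.le h4.le)
    have h8 : δ / (1 - δ) * ((m ^ (δ - 1) - y ^ (δ - 1)) * (y * a)) =
        δ / (1 - δ) * (m ^ (δ - 1) * y - y ^ (δ - 1) * y) * a := by ring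
    rw [h8, e] at h7
    linarith

variable {f g : ℂ → ℝ≥0∞} {Y : Set Circle → ℝ} {δ c : ℝ}

/-- Kolmogorov's inequality on the tree of the tiles: if `Y` increases from an arc to its halves
only by jumps to averages of `f`, then the averages of `Y ^ δ` are controlled. -/
lemma IsDyadicGrid.lintegral_layers_le (hD : IsDyadicGrid D) (hf : ∫⁻ z, f z ∂area ≠ ∞)
    (hY : ∀ I ∈ D, 0 < Y I)
    (hedge : ∀ J ∈ D, ∀ I ∈ D, J ⊆ I → arcLength J = arcLength I / 2 →
      Y J ≤ max (Y I) (avg f J)) (h0 : 0 < δ) (h1 : δ < 1) (hc : 0 ≤ c)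
    (hg : ∀ I ∈ D, ∀ᵐ z ∂area.restrict (topHalf I), g z ≤ ENNReal.ofReal (c * Y I ^ δ)) (n : ℕ) :
    ∀ I ∈ D, ∀ m, Y I ≤ m → ∫⁻ z in layers n I, g z ∂area ≤
      ENNReal.ofReal (c * (m ^ δ * boxArea I + δ / (1 - δ) * m ^ (δ - 1) * mass f I)) := by
  have hκ : 0 ≤ δ / (1 - δ) := div_nonneg h0.le (by linarith)
  induction n with
  | zero => intro I hI m hm; simp [layers_zero]
  | succ n ih =>
    intro I hI m hm
    have hmpos := (hY I hI).trans_le hm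
    obtain ⟨I₁, hI₁, I₂, hI₂, l₁, l₂, hd, hu⟩ := hD.exists_halves hI
    have hT : ∫⁻ z in shell I (arcLength I / 2) (arcLength I), g z ∂area ≤
        ENNReal.ofReal (c * (m ^ δ * tileArea I)) := by
      rw [← hD.topHalf_eq hI]
      calc ∫⁻ z in topHalf I, g z ∂area
          ≤ ∫⁻ z in topHalf I, ENNReal.ofReal (c * m ^ δ) ∂area := by
            refine lintegral_mono_ae ?_
            filter_upwards [hg I hI] with z hz
            refine hz.trans (ENNReal.ofReal_le_ofReal ?_)
            gcongr
            exact (hY I hI).le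
        _ = _ := by
          rw [setLIntegral_const, hD.area_topHalf hI, ← ENNReal.ofReal_mul (by positivity),
            mul_assoc]
    have key : ∀ J ∈ D, J ⊆ I → arcLength J = arcLength I / 2 →
        ∫⁻ z in layers n J, g z ∂area ≤
          ENNReal.ofReal (c * (m ^ δ * boxArea J + δ / (1 - δ) * m ^ (δ - 1) * mass f J)) := by
      intro J hJ hJI hl
      -- The induction carries the running maximum `m` of `Y` rather than `Y` itself, since `Y` may
      -- also decrease.
      refine (ih J hJ (max m (Y J)) (le_max_right _ _)).trans (ENNReal.ofReal_le_ofReal ?_)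
      refine mul_le_mul_of_nonneg_left (kolmogorov_step h0 h1 hmpos (hD.boxArea_pos hJ) ?_) hc
      exact (hedge J hJ I hI hJI hl).trans (max_le_max_right _ hm)
    have k₁ := key I₁ hI₁ (hu ▸ subset_union_left) l₁
    have k₂ := key I₂ hI₂ (hu ▸ subset_union_right) l₂
    refine (lintegral_layers_succ_le l₁ l₂ hu n g).trans
      ((add_le_add hT (add_le_add k₁ k₂)).trans ?_)
    have b₁ := (hD.boxArea_pos hI₁).le
    have b₂ := (hD.boxArea_pos hI₂).le
    have t := (hD.tileArea_pos hI).le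
    have f₁ := mass_nonneg f I₁
    have f₂ := mass_nonneg f I₂
    rw [← ENNReal.ofReal_add (by positivity) (by positivity),
      ← ENNReal.ofReal_add (by positivity) (by positivity)]
    refine ENNReal.ofReal_le_ofReal ?_
    have hF : mass f I₁ + mass f I₂ ≤ mass f I := by
      have := hD.mass_add_le hf hI hI₁ hI₂ l₁ l₂ hd hu
      have : 0 ≤ (∫⁻ z in topHalf I, f z ∂area).toReal := ENNReal.toReal_nonneg
      linarith
    calc _ = c * (m ^ δ * (tileArea I + (boxArea I₁ + boxArea I₂)) +
          δ / (1 - δ) * m ^ (δ - 1) * (mass f I₁ + mass f I₂)) := by ring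
      _ ≤ _ := by
        rw [tileArea_add l₁ l₂]
        gcongr

/-- Start the running maximum at `m = Y I`, bound the mass by `Y I` times the area, and use `1 + δ /
(1 - δ) = 1 / (1 - δ)`. -/
lemma IsDyadicGrid.lintegral_box_le_of_avg_le (hD : IsDyadicGrid D)
    (hf : ∫⁻ z, f z ∂area ≠ ∞) (hY : ∀ I ∈ D, 0 < Y I)
    (hedge : ∀ J ∈ D, ∀ I ∈ D, J ⊆ I → arcLength J = arcLength I / 2 →
      Y J ≤ max (Y I) (avg f J)) (havg : ∀ I ∈ D, avg f I ≤ Y I) (h0 : 0 < δ) (h1 : δ < 1)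
    (hc : 0 ≤ c)
    (hg : ∀ I ∈ D, ∀ᵐ z ∂area.restrict (topHalf I), g z ≤ ENNReal.ofReal (c * Y I ^ δ))
    (hI : I ∈ D) :
    ∫⁻ z in box I, g z ∂area ≤ ENNReal.ofReal (c / (1 - δ) * Y I ^ δ * boxArea I) := by
  have h2 : 0 < 1 - δ := by linarith
  have hYI := hY I hI
  refine lintegral_box_le g fun n => (hD.lintegral_layers_le hf hY hedge h0 h1 hc hg n I hI _
    le_rfl).trans (ENNReal.ofReal_le_ofReal ?_)
  have hb := hD.boxArea_pos hI
  have e : Y I ^ (δ - 1) * Y I = Y I ^ δ := by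
    rw [← Real.rpow_add_one hYI.ne']; simp
  rw [← hD.avg_mul_boxArea hI]
  calc _ ≤ c * (Y I ^ δ * boxArea I + δ / (1 - δ) * Y I ^ (δ - 1) * (Y I * boxArea I)) := by
        gcongr
        exact havg I hI
    _ = c * (Y I ^ δ * boxArea I + δ / (1 - δ) * (Y I ^ (δ - 1) * Y I) * boxArea I) := by ring
    _ = _ := by rw [e]; field_simp; ring

end Kolmogorov

/-! ### The reverse Hölder inequality. -/

section ReverseHolder

variable {f : ℂ → ℝ≥0∞} {M q : ℝ}

/-- A function which is comparable, on every tile, to its average over the Carleson square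
satisfies a reverse Hölder inequality. -/
lemma IsDyadicGrid.lintegral_layers_rpow_le (hD : IsDyadicGrid D) (hf : ∫⁻ z, f z ∂area ≠ ∞)
    (hM : 0 < M)
    (hle : ∀ I ∈ D, ∀ᵐ z ∂area.restrict (topHalf I), f z ≤ ENNReal.ofReal (M * avg f I))
    (hge : ∀ I ∈ D, ∀ᵐ z ∂area.restrict (topHalf I),
      ENNReal.ofReal (avg f I) ≤ ENNReal.ofReal M * f z)
    (hq : 1 < q) (hq' : (4 : ℝ) ^ (q - 1) ≤ 1 + 1 / (8 * M)) (n : ℕ) :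
    ∀ I ∈ D, ∫⁻ z in layers n I, f z ^ q ∂area ≤
      ENNReal.ofReal (2 * (M * avg f I) ^ (q - 1) * mass f I) := by
  induction n with
  | zero => intro I hI; simp [layers_zero]
  | succ n ih =>
    intro I hI
    obtain ⟨I₁, hI₁, I₂, hI₂, l₁, l₂, hd, hu⟩ := hD.exists_halves hI
    have hA := hD.avg_nonneg hI f
    set F := (∫⁻ z in topHalf I, f z ∂area).toReal with hF
    have hFo : ENNReal.ofReal F = ∫⁻ z in topHalf I, f z ∂area :=
      ENNReal.ofReal_toReal (setLIntegral_ne_top hf _)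
    have hF0 : 0 ≤ F := ENNReal.toReal_nonneg
    have hT : ∫⁻ z in shell I (arcLength I / 2) (arcLength I), f z ^ q ∂area ≤
        ENNReal.ofReal ((M * avg f I) ^ (q - 1) * F) := by
      rw [← hD.topHalf_eq hI, ENNReal.ofReal_mul (by positivity), hFo,
        ← lintegral_const_mul' _ _ ENNReal.ofReal_ne_top]
      refine lintegral_mono_ae ?_
      filter_upwards [hle I hI] with z hz
      have : f z ^ q = f z ^ (q - 1) * f z := by
        conv_rhs => rw [← ENNReal.rpow_one (f z), ← ENNReal.rpow_mul, one_mul]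
        rw [← ENNReal.rpow_add_of_nonneg _ _ (by linarith) zero_le_one]
        ring_nf
      rw [this, ← ENNReal.ofReal_rpow_of_nonneg (by positivity) (by linarith)]
      gcongr
    -- The tile carries at least the share `1 / (4 M)` of the mass of its square.
    have hbig : mass f I ≤ 4 * M * F := by
      have h1 : ENNReal.ofReal (avg f I * tileArea I) ≤ ENNReal.ofReal (M * F) := by
        rw [ENNReal.ofReal_mul hA, ← hD.area_topHalf hI, ENNReal.ofReal_mul hM.le, hFo,
          ← setLIntegral_const, ← lintegral_const_mul' _ _ ENNReal.ofReal_ne_top]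
        exact lintegral_mono_ae (hge I hI)
      have h2 := (ENNReal.ofReal_le_ofReal_iff (by positivity)).1 h1
      rw [← hD.avg_mul_boxArea hI]
      nlinarith [hD.boxArea_le_tileArea hI]
    have key : ∀ J ∈ D, J ⊆ I → arcLength J = arcLength I / 2 →
        ∫⁻ z in layers n J, f z ^ q ∂area ≤
          ENNReal.ofReal (2 * (M * avg f I) ^ (q - 1) * (1 + 1 / (8 * M)) * mass f J) := by
      intro J hJ hJI hl
      refine (ih J hJ).trans (ENNReal.ofReal_le_ofReal ?_)
      have hJ0 := mass_nonneg f J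
      have hJA := hD.avg_nonneg hJ f
      refine mul_le_mul_of_nonneg_right ?_ hJ0
      calc 2 * (M * avg f J) ^ (q - 1) ≤ 2 * (4 * (M * avg f I)) ^ (q - 1) := by
            have := hD.avg_le_of_half hf hI hJ hJI hl
            gcongr 2 * ?_ ^ (q - 1)
            nlinarith
        _ = 2 * (M * avg f I) ^ (q - 1) * 4 ^ (q - 1) := by
          rw [Real.mul_rpow (by norm_num) (by positivity)]; ring
        _ ≤ _ := by gcongr
    have k₁ := key I₁ hI₁ (hu ▸ subset_union_left) l₁
    have k₂ := key I₂ hI₂ (hu ▸ subset_union_right) l₂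
    refine (lintegral_layers_succ_le l₁ l₂ hu n _).trans
      ((add_le_add hT (add_le_add k₁ k₂)).trans ?_)
    have f₁ := mass_nonneg f I₁
    have f₂ := mass_nonneg f I₂
    rw [← ENNReal.ofReal_add (by positivity) (by positivity),
      ← ENNReal.ofReal_add (by positivity) (by positivity)]
    refine ENNReal.ofReal_le_ofReal ?_
    have hsum : F + (mass f I₁ + mass f I₂) ≤ mass f I := hD.mass_add_le hf hI hI₁ hI₂ l₁ l₂ hd hu
    have hM4 : 1 / (4 * M) * mass f I ≤ F := by
      rw [one_div_mul_eq_div, div_le_iff₀ (by positivity)]; linarith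
    -- Passing to a half costs the factor `4 ^ (q - 1) ≤ 1 + 1 / (8 M)`. The resulting excess, `1 /
    -- (4 M)` times the mass over the halves, is at most `F`, and the tile contributes only one of
    -- the two copies of `F` allowed on the right. So the factor 2 reproduces itself.
    have hin : F + 2 * (1 + 1 / (8 * M)) * (mass f I₁ + mass f I₂) ≤ 2 * mass f I := by
      have : 1 / (4 * M) * (mass f I₁ + mass f I₂) ≤ 1 / (4 * M) * mass f I := by
        gcongr; linarith
      have e : 2 * (1 + 1 / (8 * M)) * (mass f I₁ + mass f I₂) =
          2 * (mass f I₁ + mass f I₂) + 1 / (4 * M) * (mass f I₁ + mass f I₂) := by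
        field_simp; ring
      linarith
    have := mul_le_mul_of_nonneg_left hin (Real.rpow_nonneg (mul_nonneg hM.le hA) (q - 1))
    linarith

lemma IsDyadicGrid.lintegral_box_rpow_le (hD : IsDyadicGrid D) (hf : ∫⁻ z, f z ∂area ≠ ∞)
    (hM : 0 < M)
    (hle : ∀ I ∈ D, ∀ᵐ z ∂area.restrict (topHalf I), f z ≤ ENNReal.ofReal (M * avg f I))
    (hge : ∀ I ∈ D, ∀ᵐ z ∂area.restrict (topHalf I),
      ENNReal.ofReal (avg f I) ≤ ENNReal.ofReal M * f z)
    (hq : 1 < q) (hq' : (4 : ℝ) ^ (q - 1) ≤ 1 + 1 / (8 * M)) (hI : I ∈ D) :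
    ∫⁻ z in box I, f z ^ q ∂area ≤
      ENNReal.ofReal (2 * M ^ (q - 1) * avg f I ^ q * boxArea I) := by
  refine lintegral_box_le _ fun n =>
    (hD.lintegral_layers_rpow_le hf hM hle hge hq hq' n I hI).trans_eq ?_
  have hA := hD.avg_nonneg hI f
  have e : avg f I ^ (q - 1) * avg f I = avg f I ^ q := by
    rw [← Real.rpow_add_one' hA (by linarith)]; simp
  rw [← hD.avg_mul_boxArea hI, Real.mul_rpow hM.le hA, ← e]
  congr 1; ring

end ReverseHolder

end TreeInequalities

/-! ### Weights and dual weights against their averages. -/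

section Averages

variable {D : Set (Set Circle)} {I J K : Set Circle} {Ω : Set ℂ} {p N L : ℝ} {w : ℂ → ℝ}

lemma restrict_box_univ : area.restrict (box univ) = area := by
  have : box univ = disc := by
    ext z
    simp only [box, shell, sector, arcLength_univ, mem_univ, true_and, mem_ofPred_eq]
    constructor
    · exact fun h => h.1.1
    · intro h
      refine ⟨⟨h, Circle.exp z.arg, ?_⟩, ?_, ?_⟩
      · rw [Circle.coe_exp, Complex.norm_mul_exp_arg_mul_I]
      · have : ‖z‖ < 1 := by simpa [disc] using h
        linarith
      · linarith [norm_nonneg z]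
  have hm : MeasurableSet disc := measurableSet_ball
  rw [this, area, Measure.restrict_smul, Measure.restrict_restrict hm, inter_self]

lemma setLIntegral_carlesonSquare (hΩ : MeasurableSet Ω) (h : ℂ → ℝ≥0∞) (I : Set Circle) :
    ∫⁻ z in carlesonSquare I ∩ Ω, h z ∂area = ∫⁻ z in box I, Ω.indicator h z ∂area := by
  rw [carlesonSquare_ae_eq_restrict, setLIntegral_indicator hΩ, inter_comm]

lemma IsDyadicGrid.measurableSet_biUnion (hD : IsDyadicGrid D) {s : Set (Set Circle)} (hs : s ⊆ D) :
    MeasurableSet (⋃ I ∈ s, topHalf I) :=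
  MeasurableSet.biUnion (hD.countable.mono hs) fun _ hI => hD.measurableSet_topHalf (hs hI)

lemma IsDyadicGrid.ofReal_avg (hD : IsDyadicGrid D) {f : ℂ → ℝ≥0∞} (hf : ∫⁻ z, f z ∂area ≠ ∞)
    (hI : I ∈ D) :
    (∫⁻ z in box I, f z ∂area) / ENNReal.ofReal (boxArea I) = ENNReal.ofReal (avg f I) := by
  rw [← ofReal_mass hf, ← ENNReal.ofReal_div_of_pos (hD.boxArea_pos hI), avg]

/-- The weight `w` on `Ω`, extended by zero. -/
noncomputable def weightExt (Ω : Set ℂ) (w : ℂ → ℝ) : ℂ → ℝ≥0∞ :=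
  Ω.indicator fun z => ENNReal.ofReal (w z)

/-- The dual weight `w ^ (-1 / (p - 1))` on `Ω`, extended by zero. -/
noncomputable def dualExt (Ω : Set ℂ) (p : ℝ) (w : ℂ → ℝ) : ℂ → ℝ≥0∞ :=
  Ω.indicator fun z => ENNReal.ofReal (w z) ^ (-1 / (p - 1))

lemma IsDyadicGrid.bpConst_eq (hD : IsDyadicGrid D) (hΩ : MeasurableSet Ω) :
    bpConst D Ω p w = ⨆ I ∈ D, ((∫⁻ z in box I, weightExt Ω w z ∂area) / ENNReal.ofReal (boxArea I)) *
      ((∫⁻ z in box I, dualExt Ω p w z ∂area) / ENNReal.ofReal (boxArea I)) ^ (p - 1) := by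
  refine iSup_congr fun I => iSup_congr fun hI => ?_
  rw [setLIntegral_carlesonSquare hΩ, setLIntegral_carlesonSquare hΩ, hD.area_carlesonSquare hI]
  rfl

lemma IsDyadicGrid.bpConst_le (hD : IsDyadicGrid D) (hΩ : MeasurableSet Ω) (hp : 1 < p)
    {X Z : Set Circle → ℝ} (hX : ∀ I ∈ D, 0 ≤ X I) (hZ : ∀ I ∈ D, 0 ≤ Z I)
    (h₁ : ∀ I ∈ D, ∫⁻ z in box I, weightExt Ω w z ∂area ≤ ENNReal.ofReal (X I * boxArea I))
    (h₂ : ∀ I ∈ D, ∫⁻ z in box I, dualExt Ω p w z ∂area ≤ ENNReal.ofReal (Z I * boxArea I))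
    {M : ℝ} (hM : ∀ I ∈ D, X I * Z I ^ (p - 1) ≤ M) : bpConst D Ω p w ≤ ENNReal.ofReal M := by
  rw [hD.bpConst_eq hΩ]
  refine iSup₂_le fun I hI => ?_
  have hb := hD.boxArea_pos hI
  have key : ∀ {u : ℝ} {f : ℂ → ℝ≥0∞}, ∫⁻ z in box I, f z ∂area ≤ ENNReal.ofReal (u * boxArea I) →
      (∫⁻ z in box I, f z ∂area) / ENNReal.ofReal (boxArea I) ≤ ENNReal.ofReal u := by
    intro u f h
    refine ENNReal.div_le_of_le_mul (h.trans_eq ?_)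
    rw [ENNReal.ofReal_mul' hb.le]
  calc _ ≤ ENNReal.ofReal (X I) * ENNReal.ofReal (Z I) ^ (p - 1) := by
        gcongr
        · exact key (h₁ I hI)
        · exact key (h₂ I hI)
    _ = ENNReal.ofReal (X I * Z I ^ (p - 1)) := by
      rw [ENNReal.ofReal_rpow_of_nonneg (hZ I hI) (by linarith), ENNReal.ofReal_mul (hX I hI)]
    _ ≤ _ := ENNReal.ofReal_le_ofReal (hM I hI)

lemma MemBp.lintegral_weightExt_ne_top (hw : MemBp D Ω p w) (hΩ : MeasurableSet Ω) :
    ∫⁻ z, weightExt Ω w z ∂area ≠ ∞ := by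
  rw [weightExt, lintegral_indicator hΩ]
  exact hw.integrable.lintegral_lt_top.ne

/-- Look at the whole circle. Since `0 * ∞ = 0`, an infinite dual integral is compatible with a
finite constant only if `w` has integral zero. Positivity then makes `Ω` null, and the dual integral
vanishes after all. -/
lemma MemBp.lintegral_dualExt_ne_top (hw : MemBp D Ω p w) (hD : IsDyadicGrid D)
    (hΩ : MeasurableSet Ω) (hp : 1 < p) (hpos : ∀ᵐ z ∂area.restrict Ω, 0 < w z) :
    ∫⁻ z, dualExt Ω p w z ∂area ≠ ∞ := by
  have h := hw.const_lt_top
  rw [hD.bpConst_eq hΩ] at h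
  have h1 := (le_iSup₂ (f := fun I (_ : I ∈ D) =>
    ((∫⁻ z in box I, weightExt Ω w z ∂area) / ENNReal.ofReal (boxArea I)) *
    ((∫⁻ z in box I, dualExt Ω p w z ∂area) / ENNReal.ofReal (boxArea I)) ^ (p - 1))
    univ hD.univ_mem).trans_lt h
  have hb : boxArea univ = 1 := by rw [boxArea, arcLength_univ]; norm_num
  simp only [restrict_box_univ, hb, ENNReal.ofReal_one, div_one] at h1
  intro htop
  rw [htop, ENNReal.top_rpow_of_pos (by linarith)] at h1
  have h2 : ∫⁻ z, weightExt Ω w z ∂area = 0 := by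
    by_contra hne
    rw [ENNReal.mul_top hne] at h1
    exact lt_irrefl _ h1
  have h3 : area Ω = 0 := by
    by_contra hne
    rw [weightExt, lintegral_indicator hΩ,
      lintegral_eq_zero_iff' hw.integrable.aestronglyMeasurable.aemeasurable.ennreal_ofReal] at h2
    have : ∀ᵐ z ∂area.restrict Ω, False := by
      filter_upwards [h2, hpos] with z hz hz'
      simp only [Pi.zero_apply, ENNReal.ofReal_eq_zero] at hz
      linarith
    rw [Filter.eventually_false_iff_eq_bot, ae_eq_bot, Measure.restrict_eq_zero] at this
    exact hne this
  rw [dualExt, lintegral_indicator hΩ, Measure.restrict_eq_zero.2 h3, lintegral_zero_measure] at htop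
  exact ENNReal.zero_ne_top htop

lemma MemBp.avg_mul_le (hw : MemBp D Ω p w) (hD : IsDyadicGrid D)
    (hΩ : MeasurableSet Ω) (hp : 1 < p) (hpos : ∀ᵐ z ∂area.restrict Ω, 0 < w z) (hI : I ∈ D) :
    avg (weightExt Ω w) I * avg (dualExt Ω p w) I ^ (p - 1) ≤ (bpConst D Ω p w).toReal := by
  have h := hw.const_lt_top
  have h1 := le_iSup₂ (f := fun I (_ : I ∈ D) =>
    ((∫⁻ z in box I, weightExt Ω w z ∂area) / ENNReal.ofReal (boxArea I)) *
    ((∫⁻ z in box I, dualExt Ω p w z ∂area) / ENNReal.ofReal (boxArea I)) ^ (p - 1)) I hI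
  rw [← hD.bpConst_eq hΩ, hD.ofReal_avg (hw.lintegral_weightExt_ne_top hΩ) hI,
    hD.ofReal_avg (hw.lintegral_dualExt_ne_top hD hΩ hp hpos) hI,
    ENNReal.ofReal_rpow_of_nonneg (hD.avg_nonneg hI _) (by linarith),
    ← ENNReal.ofReal_mul (hD.avg_nonneg hI _)] at h1
  exact (ENNReal.ofReal_le_iff_le_toReal h.ne).1 h1

lemma OscBound.ae_topHalf (h : OscBound D Ω w L) (hD : IsDyadicGrid D) (hI : I ∈ D)
    (hIΩ : topHalf I ⊆ Ω) :
    ∀ᵐ z ∂area.restrict (topHalf I), ∀ᵐ ζ ∂area.restrict (topHalf I),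
      |Real.log (w z) - Real.log (w ζ)| ≤ L := by
  have hm := Measure.restrict_mono_set area hIΩ
  filter_upwards [ae_mono hm h, ae_restrict_mem (hD.measurableSet_topHalf hI)] with z hz hzI
  filter_upwards [ae_mono hm hz, ae_restrict_mem (hD.measurableSet_topHalf hI)] with ζ hζ hζI
  rwa [hD.dyadicDist_eq_zero hI hzI hζI, add_zero, mul_one] at hζ

/-- On one tile the dyadic distance is 0, so `w ^ e` is at most `exp (L |e|)` times its tile
average, which is at most 4 times the average over the square. -/
lemma IsDyadicGrid.ae_rpow_le_avg (hD : IsDyadicGrid D) (hI : I ∈ D) (hIΩ : topHalf I ⊆ Ω)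
    (hpos : ∀ᵐ z ∂area.restrict Ω, 0 < w z) (hosc : OscBound D Ω w L) (e : ℝ)
    (hf : ∫⁻ z, Ω.indicator (fun z => ENNReal.ofReal (w z) ^ e) z ∂area ≠ ∞) :
    ∀ᵐ z ∂area.restrict (topHalf I), w z ^ e ≤
      4 * Real.exp (L * |e|) * avg (Ω.indicator fun z => ENNReal.ofReal (w z) ^ e) I := by
  have hpos' := ae_mono (Measure.restrict_mono_set area hIΩ) hpos
  filter_upwards [ae_rpow_mul_measure_le hpos' (hosc.ae_topHalf hD hI hIΩ) e, hpos'] with z h hz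
  have hT := hD.tileArea_pos hI
  have h1 : ∫⁻ ζ in topHalf I, ENNReal.ofReal (w ζ) ^ e ∂area =
      ∫⁻ ζ in topHalf I, Ω.indicator (fun z => ENNReal.ofReal (w z) ^ e) ζ ∂area :=
    setLIntegral_congr_fun (hD.measurableSet_topHalf hI) fun ζ hζ =>
      (indicator_of_mem (hIΩ hζ) fun z => ENNReal.ofReal (w z) ^ e).symm
  rw [h1] at h
  have hA := hD.avg_nonneg hI (Ω.indicator fun z => ENNReal.ofReal (w z) ^ e)
  have h2 := h.trans (mul_le_mul_right (hD.lintegral_topHalf_le hf hI) _)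
  rw [Measure.restrict_apply_univ, hD.area_topHalf hI, ENNReal.ofReal_rpow_of_pos hz,
    ← ENNReal.ofReal_mul (by positivity), ← ENNReal.ofReal_mul (by positivity),
    ← ENNReal.ofReal_mul (by positivity), ENNReal.ofReal_le_ofReal_iff (by positivity),
    ← mul_assoc] at h2
  have := le_of_mul_le_mul_right h2 hT
  linarith

/-- Each average is bounded above by `N` over a power of the other, and the other is bounded below
by the pointwise hypothesis. So upper bounds for the weight and its dual, with the `B_p` condition,
give two-sided comparability. -/
lemma rpow_neg_bounds {A s x B r : ℝ} (hr : 0 < r) (hA : 0 ≤ A) (hs : 0 ≤ s) (hx : 0 < x)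
    (hB : 0 < B) (h₁ : x ≤ B * A) (h₂ : x ^ (-r) ≤ B * s) (hN : A * s ^ r⁻¹ ≤ N) :
    A ≤ N * B ^ r⁻¹ * x ∧ s ≤ (N * B) ^ r * x ^ (-r) := by
  have hs' : 0 < s := by
    refine lt_of_le_of_ne hs fun h => ?_
    rw [← h, mul_zero] at h₂
    exact absurd h₂ (not_le.2 (Real.rpow_pos_of_pos hx _))
  have hA' : 0 < A := by
    refine lt_of_le_of_ne hA fun h => ?_
    rw [← h, mul_zero] at h₁
    linarith
  have hi : 0 < r⁻¹ := inv_pos.2 hr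
  have e : (x ^ (-r)) ^ r⁻¹ = x⁻¹ := by
    rw [← Real.rpow_mul hx.le, neg_mul, mul_inv_cancel₀ hr.ne', Real.rpow_neg_one]
  constructor
  · have h3 := Real.rpow_le_rpow (Real.rpow_nonneg hx.le _) h₂ hi.le
    rw [e, Real.mul_rpow hB.le hs] at h3
    have h4 : 1 ≤ B ^ r⁻¹ * s ^ r⁻¹ * x := by
      rw [inv_le_iff_one_le_mul₀ hx] at h3; exact h3
    have hBp := Real.rpow_pos_of_pos hB r⁻¹
    calc A ≤ A * (B ^ r⁻¹ * s ^ r⁻¹ * x) := le_mul_of_one_le_right hA h4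
      _ = A * s ^ r⁻¹ * (B ^ r⁻¹ * x) := by ring
      _ ≤ N * (B ^ r⁻¹ * x) := by gcongr
      _ = _ := by ring
  · have h3 : s ^ r⁻¹ ≤ N * B * x⁻¹ := by
      have hNA : s ^ r⁻¹ * x ≤ N * B := by
        calc s ^ r⁻¹ * x ≤ s ^ r⁻¹ * (B * A) := by gcongr
          _ = A * s ^ r⁻¹ * B := by ring
          _ ≤ N * B := by gcongr
      rwa [← div_eq_mul_inv, le_div_iff₀ hx]
    have hNB : 0 ≤ N * B := mul_nonneg ((by positivity : 0 ≤ A * s ^ r⁻¹).trans hN) hB.le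
    have h4 := Real.rpow_le_rpow (Real.rpow_nonneg hs _) h3 hr.le
    rwa [← Real.rpow_mul hs, inv_mul_cancel₀ hr.ne', Real.rpow_one,
      Real.mul_rpow hNB (inv_nonneg.2 hx.le), Real.inv_rpow hx.le, ← Real.rpow_neg hx.le] at h4

end Averages

/-! ### Part (b): a larger power of the weight. -/

section PowerSelfImprovement

variable {D : Set (Set Circle)} {I J K : Set Circle} {Ω : Set ℂ} {p N L : ℝ} {w W : ℂ → ℝ}

lemma ae_indicator_topHalf (hD : IsDyadicGrid D) (hI : I ∈ D) (hIΩ : topHalf I ⊆ Ω)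
    (h : ℂ → ℝ≥0∞) : ∀ᵐ z ∂area.restrict (topHalf I), Ω.indicator h z = h z := by
  filter_upwards [ae_restrict_mem (hD.measurableSet_topHalf hI)] with z hz
  exact indicator_of_mem (hIΩ hz) _

/-- A Békollé--Bonami weight of bounded hyperbolic oscillation is comparable to its averages, and so
is its dual weight. -/
lemma MemBp.exists_tile_bound (hw : MemBp D Ω p w) (hD : IsDyadicGrid D) (hΩ : MeasurableSet Ω)
    (hp : 1 < p) (hpos : ∀ᵐ z ∂area.restrict Ω, 0 < w z) (hosc : OscBound D Ω w L)
    {B : ℝ} (hB₁ : 4 * Real.exp L ≤ B) (hB₂ : 4 * Real.exp (L * (p - 1)⁻¹) ≤ B)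
    (hI : I ∈ D) (hIΩ : topHalf I ⊆ Ω) :
    ∀ᵐ z ∂area.restrict (topHalf I), 0 < w z ∧ w z ≤ B * avg (weightExt Ω w) I ∧
      w z ^ (-(p - 1)⁻¹) ≤ B * avg (dualExt Ω p w) I := by
  have hf := hw.lintegral_weightExt_ne_top hΩ
  have hs := hw.lintegral_dualExt_ne_top hD hΩ hp hpos
  have e1 : (Ω.indicator fun z => ENNReal.ofReal (w z) ^ (1 : ℝ)) = weightExt Ω w := by
    simp [weightExt]
  have hr : -1 / (p - 1) = -(p - 1)⁻¹ := by rw [neg_div, one_div]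
  have e2 : (Ω.indicator fun z => ENNReal.ofReal (w z) ^ (-(p - 1)⁻¹)) = dualExt Ω p w := by
    rw [dualExt, hr]
  have hr0 : 0 < (p - 1)⁻¹ := inv_pos.2 (by linarith)
  have hA := hD.avg_nonneg hI (weightExt Ω w)
  have hS := hD.avg_nonneg hI (dualExt Ω p w)
  have h1 := hD.ae_rpow_le_avg hI hIΩ hpos hosc 1 (by rw [e1]; exact hf)
  have h2 := hD.ae_rpow_le_avg hI hIΩ hpos hosc (-(p - 1)⁻¹) (by rw [e2]; exact hs)
  rw [e1] at h1
  rw [e2, abs_neg, abs_of_pos hr0] at h2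
  filter_upwards [h1, h2, ae_mono (Measure.restrict_mono_set area hIΩ) hpos] with z h1 h2 h3
  rw [Real.rpow_one, abs_one, mul_one] at h1
  exact ⟨h3, h1.trans (by gcongr), h2.trans (by gcongr)⟩

lemma lintegral_indicator_le_of_ae_le (hΩ : MeasurableSet Ω) {g h : ℂ → ℝ≥0∞}
    (hgh : ∀ᵐ z ∂area.restrict Ω, g z ≤ h z) (S : Set ℂ) :
    ∫⁻ z in S, Ω.indicator g z ∂area ≤ ∫⁻ z in S, h z ∂area := by
  refine lintegral_mono_ae (ae_restrict_of_ae ?_)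
  filter_upwards [(ae_restrict_iff' hΩ).1 hgh] with z hz
  by_cases h : z ∈ Ω
  · rw [indicator_of_mem h]; exact hz h
  · rw [indicator_of_notMem h]; exact zero_le

lemma memBp_of_lintegral_le (hD : IsDyadicGrid D) (hΩ : MeasurableSet Ω) (hp : 1 < p)
    (hmeas : AEMeasurable w (area.restrict Ω)) (hnn : ∀ᵐ z ∂area.restrict Ω, 0 ≤ w z)
    {X Z : Set Circle → ℝ} (hX : ∀ I ∈ D, 0 ≤ X I) (hZ : ∀ I ∈ D, 0 ≤ Z I)
    (h₁ : ∀ I ∈ D, ∫⁻ z in box I, weightExt Ω w z ∂area ≤ ENNReal.ofReal (X I * boxArea I))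
    (h₂ : ∀ I ∈ D, ∫⁻ z in box I, dualExt Ω p w z ∂area ≤ ENNReal.ofReal (Z I * boxArea I))
    {M : ℝ} (hM : ∀ I ∈ D, X I * Z I ^ (p - 1) ≤ M) : MemBp D Ω p w where
  nonneg := hnn
  integrable := by
    refine ⟨hmeas.aestronglyMeasurable, ?_⟩
    rw [hasFiniteIntegral_iff_ofReal hnn, ← lintegral_indicator hΩ]
    have := h₁ univ hD.univ_mem
    rw [restrict_box_univ] at this
    exact this.trans_lt ENNReal.ofReal_lt_top
  const_lt_top := (hD.bpConst_le hΩ hp hX hZ h₁ h₂ hM).trans_lt ENNReal.ofReal_lt_top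

lemma exists_one_lt_rpow_le {M : ℝ} (hM : 0 < M) :
    ∃ q : ℝ, 1 < q ∧ (4 : ℝ) ^ (q - 1) ≤ 1 + 1 / (8 * M) := by
  have h : 1 < 1 + 1 / (8 * M) := by
    have : 0 < 1 / (8 * M) := by positivity
    linarith
  refine ⟨1 + Real.logb 4 (1 + 1 / (8 * M)), ?_, ?_⟩
  · linarith [Real.logb_pos (by norm_num : (1 : ℝ) < 4) h]
  · rw [add_sub_cancel_left, Real.rpow_logb (by norm_num) (by norm_num) (by linarith)]

/-- A Békollé--Bonami weight of bounded hyperbolic oscillation has a power larger than one which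
is again a Békollé--Bonami weight. -/
theorem MemBp.exists_rpow (hW : MemBp D disc p W) (hD : IsDyadicGrid D) (hp : 1 < p)
    (hB : IsDyadicBHO D disc W) (hΩ : MeasurableSet Ω) (hΩd : Ω ⊆ disc)
    (hae : ∀ᵐ z ∂area.restrict Ω, W z = w z) :
    ∃ q : ℝ, 1 < q ∧ MemBp D Ω p fun z => w z ^ q := by
  obtain ⟨hmeas, hpos, L, hL, hosc⟩ := hB
  have hdisc : MeasurableSet disc := measurableSet_ball
  set f := weightExt disc W with hfdef
  set s := dualExt disc p W with hsdef
  have hf : ∫⁻ z, f z ∂area ≠ ∞ := hW.lintegral_weightExt_ne_top hdisc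
  have hs : ∫⁻ z, s z ∂area ≠ ∞ := hW.lintegral_dualExt_ne_top hD hdisc hp hpos
  set r := (p - 1)⁻¹ with hrdef
  have hr0 : 0 < r := inv_pos.2 (by linarith)
  have hri : r⁻¹ = p - 1 := inv_inv _
  have hr : -1 / (p - 1) = -r := by rw [neg_div, one_div]
  set B := max (4 * Real.exp L) (4 * Real.exp (L * r)) with hBdef
  have hBpos : 0 < B := lt_max_of_lt_left (by positivity)
  set N := (bpConst D disc p W).toReal with hN
  -- One constant for all comparisons of `W` and of its dual weight with their averages, so that a
  -- single `q` serves both.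
  set M := max B (max (N * B ^ r⁻¹) ((N * B) ^ r)) with hMdef
  have hM : 0 < M := lt_max_of_lt_left hBpos
  have htile : ∀ I ∈ D, ∀ᵐ z ∂area.restrict (topHalf I),
      f z = ENNReal.ofReal (W z) ∧ s z = ENNReal.ofReal (W z ^ (-r)) ∧
      W z ≤ M * avg f I ∧ W z ^ (-r) ≤ M * avg s I ∧
      avg f I ≤ M * W z ∧ avg s I ≤ M * W z ^ (-r) := by
    intro I hI
    have hId : topHalf I ⊆ disc := fun z hz => hz.1.1
    filter_upwards [hW.exists_tile_bound hD hdisc hp hpos hosc (le_max_left _ _)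
      (le_max_right _ _) hI hId, ae_indicator_topHalf hD hI hId fun z => ENNReal.ofReal (W z),
      ae_indicator_topHalf hD hI hId fun z => ENNReal.ofReal (W z) ^ (-1 / (p - 1))]
      with z ⟨hz, h1, h2⟩ h3 h4
    have hA := hD.avg_nonneg hI f
    have hS := hD.avg_nonneg hI s
    have hNI : avg f I * avg s I ^ r⁻¹ ≤ N := by
      rw [hri]; exact hW.avg_mul_le hD hdisc hp hpos hI
    obtain ⟨b1, b2⟩ := rpow_neg_bounds hr0 hA hS hz hBpos h1 h2
      hNI
    have hzr := Real.rpow_pos_of_pos hz (-r)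
    refine ⟨h3, ?_, h1.trans ?_, h2.trans ?_, b1.trans ?_, b2.trans ?_⟩
    · rw [← ENNReal.ofReal_rpow_of_pos hz, ← hr]; exact h4
    · gcongr; exact le_max_left _ _
    · gcongr; exact le_max_left _ _
    · gcongr; exact (le_max_left _ _).trans (le_max_right _ _)
    · gcongr; exact (le_max_right _ _).trans (le_max_right _ _)
  obtain ⟨q, hq, hq4⟩ := exists_one_lt_rpow_le hM
  have hRf := fun I (hI : I ∈ D) => hD.lintegral_box_rpow_le hf hM
    (fun I hI => by
      filter_upwards [htile I hI] with z ⟨h1, h2, h3, h4, h5, h6⟩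
      rw [h1]; exact ENNReal.ofReal_le_ofReal h3)
    (fun I hI => by
      filter_upwards [htile I hI] with z ⟨h1, h2, h3, h4, h5, h6⟩
      rw [h1, ← ENNReal.ofReal_mul hM.le]; exact ENNReal.ofReal_le_ofReal h5) hq hq4 hI
  have hRs := fun I (hI : I ∈ D) => hD.lintegral_box_rpow_le hs hM
    (fun I hI => by
      filter_upwards [htile I hI] with z ⟨h1, h2, h3, h4, h5, h6⟩
      rw [h2]; exact ENNReal.ofReal_le_ofReal h4)
    (fun I hI => by
      filter_upwards [htile I hI] with z ⟨h1, h2, h3, h4, h5, h6⟩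
      rw [h2, ← ENNReal.ofReal_mul hM.le]; exact ENNReal.ofReal_le_ofReal h6) hq hq4 hI
  have hposΩ : ∀ᵐ z ∂area.restrict Ω, 0 < W z := ae_mono (Measure.restrict_mono_set area hΩd) hpos
  have hmΩ : AEMeasurable w (area.restrict Ω) :=
    (hmeas.mono_measure (Measure.restrict_mono_set area hΩd)).congr hae
  refine ⟨q, hq, memBp_of_lintegral_le hD hΩ hp (hmΩ.pow_const q) ?_
    (X := fun I => 2 * M ^ (q - 1) * avg f I ^ q) (Z := fun I => 2 * M ^ (q - 1) * avg s I ^ q)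
    (M := (2 * M ^ (q - 1)) ^ p * N ^ q) ?_ ?_ ?_ ?_ ?_⟩
  · filter_upwards [hposΩ, hae] with z h1 h2
    rw [← h2]; exact (Real.rpow_pos_of_pos h1 q).le
  · intro I hI
    have := hD.avg_nonneg hI f
    positivity
  · intro I hI
    have := hD.avg_nonneg hI s
    positivity
  · intro I hI
    refine (lintegral_indicator_le_of_ae_le hΩ ?_ _).trans (hRf I hI)
    filter_upwards [hposΩ, hae, ae_restrict_mem hΩ] with z h1 h2 h3
    rw [hfdef, weightExt, indicator_of_mem (hΩd h3), ← h2, ENNReal.ofReal_rpow_of_pos h1]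
  · intro I hI
    refine (lintegral_indicator_le_of_ae_le hΩ ?_ _).trans (hRs I hI)
    filter_upwards [hposΩ, hae, ae_restrict_mem hΩ] with z h1 h2 h3
    rw [hsdef, dualExt, indicator_of_mem (hΩd h3), ← h2, ← ENNReal.ofReal_rpow_of_pos h1,
      ← ENNReal.rpow_mul, ← ENNReal.rpow_mul, mul_comm]
  · intro I hI
    have hA := hD.avg_nonneg hI f
    have hS := hD.avg_nonneg hI s
    have hk : 0 < 2 * M ^ (q - 1) := by positivity
    have hNI := hW.avg_mul_le hD hdisc hp hpos hI
    calc 2 * M ^ (q - 1) * avg f I ^ q * (2 * M ^ (q - 1) * avg s I ^ q) ^ (p - 1)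
        = 2 * M ^ (q - 1) * (2 * M ^ (q - 1)) ^ (p - 1) * (avg f I * avg s I ^ (p - 1)) ^ q := by
          rw [Real.mul_rpow hk.le (by positivity), Real.mul_rpow hA (by positivity),
            ← Real.rpow_mul hS, ← Real.rpow_mul hS, mul_comm q]
          ring
      _ = (2 * M ^ (q - 1)) ^ p * (avg f I * avg s I ^ (p - 1)) ^ q := by
          congr 1
          rw [mul_comm, ← Real.rpow_add_one hk.ne']; simp
      _ ≤ _ := by gcongr

end PowerSelfImprovement

/-! ### A function between two barriers on the tree. -/

section Barriers

variable {D : Set (Set Circle)} {I J K : Set Circle} {Ω : Set ℂ} {p N L : ℝ} {w W : ℂ → ℝ}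

lemma clamp_spec {A s r u : ℝ} (hr : 0 < r) (hs : 0 ≤ s) (hAs : A * s ^ r⁻¹ ≤ 1) (hu : 0 < u) :
    ∃ c : ℝ, 0 < c ∧ A ≤ c ∧ s ≤ c ^ (-r) ∧ c ≤ max u A ∧ c ^ (-r) ≤ max (u ^ (-r)) s := by
  -- The witness below is `u` projected onto `[A, s ^ (-1 / r)]`. The upper end means `∞` when `s =
  -- 0`, whereas `Real.rpow` would give 0; taking the maximum before the power avoids this.
  set t := max (u ^ (-r)) s with ht
  have htpos : 0 < t := lt_max_of_lt_left (Real.rpow_pos_of_pos hu _)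
  have hb : 0 < t ^ (-r⁻¹) := Real.rpow_pos_of_pos htpos _
  have hi : -r⁻¹ * -r = 1 := by rw [neg_mul_neg, inv_mul_cancel₀ hr.ne']
  have hbr : (t ^ (-r⁻¹)) ^ (-r) = t := by rw [← Real.rpow_mul htpos.le, hi, Real.rpow_one]
  have hbu : t ^ (-r⁻¹) ≤ u := by
    have := Real.rpow_le_rpow_of_nonpos (Real.rpow_pos_of_pos hu (-r)) (le_max_left _ s)
      (by simpa using hr.le : -r⁻¹ ≤ 0)
    rwa [← Real.rpow_mul hu.le, mul_comm, hi, Real.rpow_one] at this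
  refine ⟨max A (t ^ (-r⁻¹)), lt_max_of_lt_right hb, le_max_left _ _, ?_, ?_, ?_⟩
  · rcases le_total A (t ^ (-r⁻¹)) with h | h
    · rw [max_eq_right h, hbr]; exact le_max_right _ _
    · rw [max_eq_left h]
      have hA := hb.trans_le h
      have h1 : s ^ r⁻¹ ≤ A⁻¹ := by
        rw [inv_eq_one_div A, le_div_iff₀ hA]; linarith
      have h2 := Real.rpow_le_rpow (Real.rpow_nonneg hs _) h1 hr.le
      rwa [← Real.rpow_mul hs, inv_mul_cancel₀ hr.ne', Real.rpow_one, Real.inv_rpow hA.le,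
        ← Real.rpow_neg hA.le] at h2
  · exact max_le (le_max_right _ _) (hbu.trans (le_max_left _ _))
  · have := Real.rpow_le_rpow_of_nonpos hb (le_max_right A _) (by linarith : -r ≤ 0)
    rwa [hbr] at this

/-- The union of the arcs of twice the length that contain `I`. -/
def parent (D : Set (Set Circle)) (I : Set Circle) : Set Circle :=
  ⋃₀ {J | J ∈ D ∧ I ⊆ J ∧ arcLength I = arcLength J / 2}

lemma IsDyadicGrid.parent_eq (hD : IsDyadicGrid D) (hI : I ∈ D) (hJ : J ∈ D) (h : J ⊆ I)
    (hl : arcLength J = arcLength I / 2) : parent D J = I := by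
  have : {K | K ∈ D ∧ J ⊆ K ∧ arcLength J = arcLength K / 2} = {I} := by
    ext K
    simp only [mem_ofPred_eq, mem_singleton_iff]
    obtain ⟨x, hx⟩ := hD.nonempty hJ
    exact ⟨fun hK => hD.eq_of_mem hK.1 hI (by linarith [hK.2.2]) (hK.2.1 hx) (h hx),
      fun hK => hK ▸ ⟨hI, h, hl⟩⟩
  rw [parent, this, sUnion_singleton]

/-- Between the barriers `A` and `s ^ (-1 / r)` there is a positive function on the grid which
changes from an arc to its halves only if it has to. -/
lemma IsDyadicGrid.exists_between (hD : IsDyadicGrid D) {A s : Set Circle → ℝ} {r : ℝ} (hr : 0 < r)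
    (hs : ∀ I ∈ D, 0 ≤ s I) (hAs : ∀ I ∈ D, A I * s I ^ r⁻¹ ≤ 1) :
    ∃ V : Set Circle → ℝ, (∀ I ∈ D, 0 < V I ∧ A I ≤ V I ∧ s I ≤ V I ^ (-r)) ∧
      ∀ J ∈ D, ∀ I ∈ D, J ⊆ I → arcLength J = arcLength I / 2 →
        V J ≤ max (V I) (A J) ∧ V J ^ (-r) ≤ max (V I ^ (-r)) (s J) := by
  have key : ∀ (I : Set Circle) (u : ℝ), ∃ c : ℝ, I ∈ D → 0 < u →
      0 < c ∧ A I ≤ c ∧ s I ≤ c ^ (-r) ∧ c ≤ max u (A I) ∧ c ^ (-r) ≤ max (u ^ (-r)) (s I) := by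
    intro I u
    by_cases h : I ∈ D ∧ 0 < u
    · obtain ⟨c, hc⟩ := clamp_spec hr (hs I h.1) (hAs I h.1) h.2
      exact ⟨c, fun _ _ => hc⟩
    · exact ⟨0, fun h1 h2 => absurd ⟨h1, h2⟩ h⟩
  choose clamp hclamp using key
  have hdy := hD.dyadic
  choose! lev hlev using hdy
  -- `U n` is meaningful on generation `n` only: each value is the parent's value, clamped. The
  -- start 1 at the root is arbitrary.
  let U : ℕ → Set Circle → ℝ := fun n =>
    Nat.rec (fun I => clamp I 1) (fun _ u I => clamp I (u (parent D I))) n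
  have hUs : ∀ n I, U (n + 1) I = clamp I (U n (parent D I)) := fun n I => rfl
  have hlevs : ∀ J ∈ D, ∀ I ∈ D, arcLength J = arcLength I / 2 → lev J = lev I + 1 := by
    intro J hJ I hI h
    rw [hlev J hJ, hlev I hI] at h
    have h' : (1 / 2 : ℝ) ^ lev J = (1 / 2) ^ (lev I + 1) := by rw [h, pow_succ]; ring
    exact pow_right_injective₀ (by norm_num) (by norm_num) h'
  have hex : ∀ n, ∀ I ∈ D, lev I = n + 1 →
      ∃ P ∈ D, I ⊆ P ∧ arcLength I = arcLength P / 2 := by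
    intro n I hI hn
    obtain ⟨x, hx⟩ := hD.nonempty hI
    obtain ⟨P, hP, -, hxP, hl⟩ := hD.exists_subset_of_mem hD.univ_mem (mem_univ x) n
    rw [arcLength_univ, one_mul] at hl
    have hIP : arcLength I = arcLength P / 2 := by rw [hlev I hI, hn, hl]; ring
    exact ⟨P, hP, hD.subset_of_mem hI hP (by linarith [hD.arcLength_pos hP]) hx hxP, hIP⟩
  have hUpos : ∀ n, ∀ I ∈ D, lev I = n → 0 < U n I := by
    intro n
    induction n with
    | zero => intro I hI _; exact (hclamp I 1 hI one_pos).1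
    | succ n ih =>
      intro I hI hn
      obtain ⟨P, hP, hIP, hl⟩ := hex n I hI hn
      have hp := hD.parent_eq hP hI hIP hl
      have := hlevs I hI P hP hl
      rw [hUs, hp]
      exact (hclamp I _ hI (ih P hP (by omega))).1
  refine ⟨fun I => U (lev I) I, fun I hI => ?_, fun J hJ I hI hJI hl => ?_⟩
  · obtain hn | ⟨n, hn⟩ : lev I = 0 ∨ ∃ n, lev I = n + 1 := by
      cases lev I with
      | zero => exact Or.inl rfl
      | succ n => exact Or.inr ⟨n, rfl⟩
    · have := hclamp I 1 hI one_pos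
      simp only [hn]
      exact ⟨this.1, this.2.1, this.2.2.1⟩
    · obtain ⟨P, hP, hIP, hl⟩ := hex n I hI hn
      have hp := hD.parent_eq hP hI hIP hl
      have hlP := hlevs I hI P hP hl
      have := hclamp I (U n P) hI (hUpos n P hP (by omega))
      simp only [hn, hUs, hp]
      exact ⟨this.1, this.2.1, this.2.2.1⟩
  · have := hclamp J (U (lev I) I) hJ (hUpos _ I hI rfl)
    simp only [hlevs J hJ I hI hl, hUs, hD.parent_eq hI hJ hJI hl]
    exact this.2.2.2

lemma IsDyadicGrid.ae_restrict_disc (hD : IsDyadicGrid D) {P : ℂ → Prop} :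
    (∀ᵐ z ∂area.restrict disc, P z) ↔ ∀ I ∈ D, ∀ᵐ z ∂area.restrict (topHalf I), P z := by
  rw [hD.disc_eq]
  exact ae_restrict_biUnion_iff _ hD.countable _

/-- Compare through `g` at both tiles: `2 c₀ + 2 c₁ β ≤ (2 c₀ + 2 c₁) (1 + β)`, where `β` is the
dyadic distance. -/
lemma IsDyadicGrid.oscBound_of_tile (hD : IsDyadicGrid D) {g : Set Circle → ℝ} {c₀ c₁ : ℝ}
    (hc₀ : 0 ≤ c₀) (hc₁ : 0 ≤ c₁)
    (hW : ∀ I ∈ D, ∀ᵐ z ∂area.restrict (topHalf I), |Real.log (W z) - g I| ≤ c₀)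
    (hg : ∀ Q ∈ D, ∀ P ∈ D, Q ⊆ P → arcLength Q = arcLength P / 2 → |g Q - g P| ≤ c₁) :
    OscBound D disc W (2 * c₀ + 2 * c₁) := by
  refine hD.ae_restrict_disc.2 fun I hI => ?_
  filter_upwards [hW I hI, ae_restrict_mem (hD.measurableSet_topHalf hI)] with z hz hzI
  refine hD.ae_restrict_disc.2 fun J hJ => ?_
  filter_upwards [hW J hJ, ae_restrict_mem (hD.measurableSet_topHalf hJ)] with ζ hζ hζJ
  obtain ⟨h1, h2⟩ := hD.abs_sub_le_dyadicDist hc₁ hg hI hJ hzI hζJ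
  have h3 := abs_sub_le (Real.log (W z)) (g I) (Real.log (W ζ))
  have h4 := abs_sub_le (g I) (g J) (Real.log (W ζ))
  rw [abs_sub_comm (g J)] at h4
  nlinarith [mul_nonneg hc₀ h1]

lemma IsDyadicGrid.aemeasurable_of_tile (hD : IsDyadicGrid D)
    (hW : ∀ I ∈ D, AEMeasurable W (area.restrict (topHalf I))) :
    AEMeasurable W (area.restrict disc) := by
  have := hD.countable.to_subtype
  rw [hD.disc_eq, biUnion_eq_iUnion]
  exact aemeasurable_iUnion_iff.2 fun I => hW I I.2

lemma avg_const_mul {C : ℝ} (hC : 0 ≤ C) (f : ℂ → ℝ≥0∞) (I : Set Circle) :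
    avg (fun z => ENNReal.ofReal C * f z) I = C * avg f I := by
  rw [avg, avg, mass, mass, lintegral_const_mul' _ _ ENNReal.ofReal_ne_top, ENNReal.toReal_mul,
    ENNReal.toReal_ofReal hC, mul_div_assoc]

/-- The bound for the ratio of a weight to its tile function. -/
noncomputable def ratioBound (q p L N : ℝ) : ℝ :=
  max (4 * Real.exp (q * L) + 4 * Real.exp (q * L * (p - 1)⁻¹))
    ((4 * Real.exp (q * L) + 4 * Real.exp (q * L * (p - 1)⁻¹)) ^ (p - 1) * (N + 1))

lemma one_le_ratioBound {q p L N : ℝ} (hq : 0 < q) (hL : 0 ≤ L) : 1 ≤ ratioBound q p L N := by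
  refine le_max_of_le_left ?_
  have h1 : 1 ≤ Real.exp (q * L) := Real.one_le_exp (by positivity)
  have h2 := Real.exp_pos (q * L * (p - 1)⁻¹)
  linarith

end Barriers

/-! ### Part (a): the extension to the disc. -/

section Extension

variable {D : Set (Set Circle)} {I J K : Set Circle} {Ω : Set ℂ} {p q N L : ℝ} {w W : ℂ → ℝ}

lemma le_of_rpow_neg_le {x y B M r : ℝ} (hr : 0 < r) (hx : 0 < x) (hy : 0 < y) (hB : 0 < B)
    (hM : 0 < M) (h : x ^ (-r) ≤ B * M ^ r * y ^ (-r)) : y ≤ B ^ r⁻¹ * M * x := by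
  have h1 := Real.rpow_le_rpow (Real.rpow_nonneg hx.le _) h (inv_pos.2 hr).le
  have e : -r * r⁻¹ = -1 := by rw [neg_mul, mul_inv_cancel₀ hr.ne']
  rwa [← Real.rpow_mul hx.le, Real.mul_rpow (by positivity) (by positivity),
    Real.mul_rpow hB.le (by positivity), ← Real.rpow_mul hy.le, ← Real.rpow_mul hM.le, e,
    mul_inv_cancel₀ hr.ne', Real.rpow_one, Real.rpow_neg_one, Real.rpow_neg_one,
    inv_le_iff_one_le_mul₀ hx, ← div_eq_mul_inv, div_mul_eq_mul_div, one_le_div hy] at h1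

/-- A weight on the disc which is comparable, on every tile, to the power `δ < 1` of a function
lying between the averages of `f` and the power `-(p - 1)` of the averages of `s`, and jumping only
to those averages, is a Békollé--Bonami weight of bounded hyperbolic oscillation. -/
theorem IsDyadicGrid.memBp_of_tile (hD : IsDyadicGrid D) (hp : 1 < p) {f s : ℂ → ℝ≥0∞}
    (hf : ∫⁻ z, f z ∂area ≠ ∞) (hs : ∫⁻ z, s z ∂area ≠ ∞) {V : Set Circle → ℝ}
    (hV : ∀ I ∈ D, 0 < V I ∧ avg f I ≤ V I ∧ avg s I ≤ V I ^ (-(p - 1)⁻¹))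
    (hedge : ∀ J ∈ D, ∀ I ∈ D, J ⊆ I → arcLength J = arcLength I / 2 →
      V J ≤ max (V I) (avg f J) ∧
        V J ^ (-(p - 1)⁻¹) ≤ max (V I ^ (-(p - 1)⁻¹)) (avg s J))
    {δ c : ℝ} (h0 : 0 < δ) (h1 : δ < 1) (hc : 1 ≤ c)
    (hmeas : ∀ I ∈ D, AEMeasurable W (area.restrict (topHalf I)))
    (hW : ∀ I ∈ D, ∀ᵐ z ∂area.restrict (topHalf I),
      0 < W z ∧ W z ≤ c * V I ^ δ ∧ V I ^ δ ≤ c * W z) :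
    MemBp D disc p W ∧ IsDyadicBHO D disc W ∧
      bpConst D disc p W ≤
        ENNReal.ofReal (c / (1 - δ) * (c ^ (p - 1)⁻¹ / (1 - δ)) ^ (p - 1)) ∧
      oscConst D disc W ≤ 2 * Real.log c + 2 * (p * Real.log 4) := by
  have hp0 : 0 < p - 1 := by linarith
  set r := (p - 1)⁻¹ with hr
  have hr0 : 0 < r := inv_pos.2 hp0
  have hδ : 0 < 1 - δ := by linarith
  have hcpos : 0 < c := by linarith
  have hdisc : MeasurableSet disc := measurableSet_ball
  have hmW := hD.aemeasurable_of_tile hmeas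
  have hpos : ∀ᵐ z ∂area.restrict disc, 0 < W z :=
    hD.ae_restrict_disc.2 fun I hI => (hW I hI).mono fun z hz => hz.1
  have hlog4 : 0 ≤ Real.log 4 := Real.log_nonneg (by norm_num)
  have hosc : OscBound D disc W (2 * Real.log c + 2 * (p * Real.log 4)) := by
    refine hD.oscBound_of_tile (g := fun I => δ * Real.log (V I)) (Real.log_nonneg hc)
      (by positivity) ?_ ?_
    · intro I hI
      have hVI := (hV I hI).1
      filter_upwards [hW I hI] with z ⟨hz, h2, h3⟩
      have hVδ := Real.rpow_pos_of_pos hVI δ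
      have h2' := Real.log_le_log hz h2
      have h3' := Real.log_le_log hVδ h3
      rw [Real.log_mul hcpos.ne' hVδ.ne', Real.log_rpow hVI] at h2'
      rw [Real.log_mul hcpos.ne' hz.ne', Real.log_rpow hVI] at h3'
      rw [abs_le]
      constructor <;> linarith
    · intro Q hQ P hP hQP hl
      have hVQ := (hV Q hQ).1
      obtain ⟨hVP, hfP, hsP⟩ := hV P hP
      obtain ⟨e1, e2⟩ := hedge Q hQ P hP hQP hl
      have hVPr := Real.rpow_pos_of_pos hVP (-r)
      -- A rise of `V` stops at an average over `Q`, at most 4 times that over `P`, which the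
      -- barrier bounds. The same for `V ^ (-r)` limits the fall of `V`.
      have u1 : V Q ≤ 4 * V P := e1.trans (max_le (by linarith)
        ((hD.avg_le_of_half hf hP hQ hQP hl).trans (by linarith)))
      have u2 : V Q ^ (-r) ≤ 4 * V P ^ (-r) := e2.trans (max_le (by linarith)
        ((hD.avg_le_of_half hs hP hQ hQP hl).trans (by linarith)))
      have v1 := Real.log_le_log hVQ u1
      have v2 := Real.log_le_log (Real.rpow_pos_of_pos hVQ _) u2
      rw [Real.log_mul (by norm_num) hVP.ne'] at v1
      rw [Real.log_mul (by norm_num) hVPr.ne', Real.log_rpow hVQ, Real.log_rpow hVP] at v2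
      have v3 : Real.log (V P) - Real.log (V Q) ≤ (p - 1) * Real.log 4 := by
        have := mul_le_mul_of_nonneg_left v2 hp0.le
        have e : (p - 1) * r = 1 := mul_inv_cancel₀ hp0.ne'
        linear_combination this - (Real.log (V P) - Real.log (V Q)) * e
      have hpl : 0 ≤ (p - 1) * Real.log 4 := by positivity
      have h4 : |Real.log (V Q) - Real.log (V P)| ≤ p * Real.log 4 := by
        rw [abs_le]
        constructor <;> linarith
      rw [← mul_sub, abs_mul, abs_of_pos h0]
      exact (mul_le_of_le_one_left (abs_nonneg _) h1.le).trans h4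
  have hX : ∀ I ∈ D, ∫⁻ z in box I, weightExt disc W z ∂area ≤
      ENNReal.ofReal (c / (1 - δ) * V I ^ δ * boxArea I) := by
    intro I hI
    refine hD.lintegral_box_le_of_avg_le hf (fun I hI => (hV I hI).1)
      (fun J hJ I hI hJI hl => (hedge J hJ I hI hJI hl).1) (fun I hI => (hV I hI).2.1) h0 h1
      hcpos.le (fun I hI => ?_) hI
    filter_upwards [hW I hI, ae_indicator_topHalf hD hI (fun z (hz : z ∈ topHalf I) => hz.1.1)
      fun z => ENNReal.ofReal (W z)] with z hz h
    rw [weightExt, h]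
    exact ENNReal.ofReal_le_ofReal hz.2.1
  have hZ : ∀ I ∈ D, ∫⁻ z in box I, dualExt disc p W z ∂area ≤
      ENNReal.ofReal (c ^ r / (1 - δ) * (V I ^ (-r)) ^ δ * boxArea I) := by
    intro I hI
    refine hD.lintegral_box_le_of_avg_le hs (Y := fun I => V I ^ (-r))
      (fun I hI => Real.rpow_pos_of_pos (hV I hI).1 _)
      (fun J hJ I hI hJI hl => (hedge J hJ I hI hJI hl).2) (fun I hI => (hV I hI).2.2) h0 h1
      (by positivity) (fun I hI => ?_) hI
    have hVI := (hV I hI).1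
    filter_upwards [hW I hI, ae_indicator_topHalf hD hI (fun z (hz : z ∈ topHalf I) => hz.1.1)
      fun z => ENNReal.ofReal (W z) ^ (-1 / (p - 1))] with z ⟨hz, h2, h3⟩ h
    have hr' : -1 / (p - 1) = -r := by rw [neg_div, one_div]
    rw [dualExt, h, hr', ENNReal.ofReal_rpow_of_pos hz]
    refine ENNReal.ofReal_le_ofReal ?_
    have h4 := Real.rpow_le_rpow_of_nonpos (Real.rpow_pos_of_pos hVI δ) h3
      (by linarith : -r ≤ 0)
    rw [Real.mul_rpow hcpos.le hz.le, Real.rpow_neg hcpos.le, ← Real.rpow_mul hVI.le,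
      inv_mul_le_iff₀ (by positivity)] at h4
    rwa [← Real.rpow_mul hVI.le, mul_comm (-r) δ]
  have hM : ∀ I ∈ D, c / (1 - δ) * V I ^ δ * (c ^ r / (1 - δ) * (V I ^ (-r)) ^ δ) ^ (p - 1) ≤
      c / (1 - δ) * (c ^ r / (1 - δ)) ^ (p - 1) := by
    intro I hI
    have hVI := (hV I hI).1
    -- The cancellation that makes the `B_p` bound independent of `I`: `r (p - 1) = 1`.
    have e : V I ^ δ * ((V I ^ (-r)) ^ δ) ^ (p - 1) = 1 := by
      rw [← Real.rpow_mul hVI.le, ← Real.rpow_mul hVI.le, ← Real.rpow_add hVI]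
      have : δ + -r * δ * (p - 1) = 0 := by rw [hr]; field_simp; ring
      rw [this, Real.rpow_zero]
    rw [Real.mul_rpow (by positivity) (by positivity)]
    refine le_of_eq ?_
    linear_combination c / (1 - δ) * (c ^ r / (1 - δ)) ^ (p - 1) * e
  have hXn : ∀ I ∈ D, 0 ≤ c / (1 - δ) * V I ^ δ := fun I hI => by
    have := (hV I hI).1
    positivity
  have hZn : ∀ I ∈ D, 0 ≤ c ^ r / (1 - δ) * (V I ^ (-r)) ^ δ := fun I hI => by
    have := (hV I hI).1
    positivity
  have hL : 0 ≤ 2 * Real.log c + 2 * (p * Real.log 4) := by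
    have := Real.log_nonneg hc
    positivity
  exact ⟨memBp_of_lintegral_le hD hdisc hp hmW (hpos.mono fun z hz => hz.le) hXn hZn hX hZ hM,
    ⟨hmW, hpos, _, hL, hosc⟩, hD.bpConst_le hdisc hp hXn hZn hX hZ hM,
    csInf_le ⟨0, fun _ h => h.1⟩ ⟨hL, hosc⟩⟩

/-- A nearly optimal constant avoids proving that the infimum is attained; hence `oscConst D Ω w +
1` in the final constants. -/
lemma IsDyadicBHO.exists_oscBound (hw : IsDyadicBHO D Ω w) :
    ∃ L : ℝ, 0 ≤ L ∧ L ≤ oscConst D Ω w + 1 ∧ OscBound D Ω w L := by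
  obtain ⟨L, ⟨h0, h1⟩, h2⟩ := exists_lt_of_csInf_lt
    (s := {L : ℝ | 0 ≤ L ∧ OscBound D Ω w L}) hw.exists_bound (lt_add_one _)
  exact ⟨L, h0, h2.le, h1⟩

lemma OscBound.rpow (h : OscBound D Ω w L) (hpos : ∀ᵐ z ∂area.restrict Ω, 0 < w z) (hq : 0 ≤ q) :
    OscBound D Ω (fun z => w z ^ q) (q * L) := by
  filter_upwards [h, hpos] with z hz hz0
  filter_upwards [hz, hpos] with ζ hζ hζ0
  rw [Real.log_rpow hz0, Real.log_rpow hζ0, ← mul_sub, abs_mul, abs_of_nonneg hq, mul_assoc]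
  gcongr

open Classical in
/-- If a power larger than one of a weight of bounded hyperbolic oscillation on a union of tiles is
a Békollé--Bonami weight there, then the weight extends to a Békollé--Bonami weight of bounded
hyperbolic oscillation on the disc. -/
theorem IsDyadicBHO.exists_extension (hw : IsDyadicBHO D Ω w) (hD : IsDyadicGrid D) (hp : 1 < p)
    (hq : 1 < q) {𝒥 : Set (Set Circle)} (h𝒥 : 𝒥 ⊆ D) (hΩ : Ω = ⋃ I ∈ 𝒥, topHalf I)
    (hv : MemBp D Ω p fun z => w z ^ q) {c : ℝ}
    (hc : c = ratioBound q p (oscConst D Ω w + 1) (bpConst D Ω p fun z => w z ^ q).toReal) :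
    ∃ W : ℂ → ℝ, MemBp D disc p W ∧ IsDyadicBHO D disc W ∧
      (∀ᵐ z ∂area.restrict Ω, W z = w z) ∧
      bpConst D disc p W ≤ ENNReal.ofReal
        (c / (1 - 1 / q) * (c ^ (p - 1)⁻¹ / (1 - 1 / q)) ^ (p - 1)) ∧
      oscConst D disc W ≤ 2 * Real.log c + 2 * (p * Real.log 4) := by
  have hq0 : 0 < q := by linarith
  have hp0 : 0 < p - 1 := by linarith
  have hΩm : MeasurableSet Ω := hΩ ▸ hD.measurableSet_biUnion h𝒥
  obtain ⟨L, hL0, hL1, hosc⟩ := hw.exists_oscBound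
  have hposv : ∀ᵐ z ∂area.restrict Ω, 0 < w z ^ q := hw.pos.mono fun z hz =>
    Real.rpow_pos_of_pos hz q
  have hoscv := hosc.rpow hw.pos hq0.le
  set v := fun z => w z ^ q with hvdef
  set N := (bpConst D Ω p v).toReal with hN
  have hN0 : 0 ≤ N := ENNReal.toReal_nonneg
  set r := (p - 1)⁻¹ with hr
  have hr0 : 0 < r := inv_pos.2 hp0
  have hri : r⁻¹ = p - 1 := inv_inv _
  set f := weightExt Ω v
  set s₀ := dualExt Ω p v
  have hf : ∫⁻ z, f z ∂area ≠ ∞ := hv.lintegral_weightExt_ne_top hΩm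
  have hs₀ : ∫⁻ z, s₀ z ∂area ≠ ∞ := hv.lintegral_dualExt_ne_top hD hΩm hp hposv
  -- Rescales the dual weight so that the product of averages is at most 1 and the barriers are
  -- ordered; `N + 1` avoids a vanishing `N`.
  set C := (N + 1) ^ (-r) with hC
  have hCpos : 0 < C := by positivity
  set s := fun z => ENNReal.ofReal C * s₀ z with hs'
  have hs : ∫⁻ z, s z ∂area ≠ ∞ := by
    rw [hs', lintegral_const_mul' _ _ ENNReal.ofReal_ne_top]
    exact ENNReal.mul_ne_top ENNReal.ofReal_ne_top hs₀
  have havgs : ∀ I, avg s I = C * avg s₀ I := avg_const_mul hCpos.le s₀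
  have hCr : C ^ r⁻¹ = (N + 1)⁻¹ := by
    rw [hC, ← Real.rpow_mul (by positivity), neg_mul, mul_inv_cancel₀ hr0.ne', Real.rpow_neg_one]
  obtain ⟨V, hV, hedge⟩ := hD.exists_between (A := avg f) (s := avg s) hr0
    (fun I hI => hD.avg_nonneg hI s) (fun I hI => by
      rw [havgs, Real.mul_rpow hCpos.le (hD.avg_nonneg hI _), hCr, mul_left_comm,
        inv_mul_le_iff₀ (by positivity), mul_one, hri]
      exact (hv.avg_mul_le hD hΩm hp hposv hI).trans (by simp [hN]))
  set B := 4 * Real.exp (q * (oscConst D Ω w + 1)) +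
    4 * Real.exp (q * (oscConst D Ω w + 1) * r) with hB
  have hBpos : 0 < B := by positivity
  have hc' : c = max B (B ^ (p - 1) * (N + 1)) := hc
  have hc1 : 1 ≤ c := hc ▸ one_le_ratioBound hq0 (hL0.trans hL1)
  have hδ0 : 0 < 1 / q := by positivity
  have hδ1 : 1 / q < 1 := by rw [div_lt_one hq0]; exact hq
  have hcδ : c ^ (1 / q) ≤ c := by
    calc c ^ (1 / q) ≤ c ^ (1 : ℝ) := Real.rpow_le_rpow_of_exponent_le hc1 hδ1.le
      _ = c := Real.rpow_one c
  have htile : ∀ I ∈ D, topHalf I ⊆ Ω → ∀ᵐ z ∂area.restrict (topHalf I),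
      0 < w z ∧ w z ≤ c * V I ^ (1 / q) ∧ V I ^ (1 / q) ≤ c * w z := by
    intro I hI hIΩ
    have hB1 : 4 * Real.exp (q * L) ≤ B := by
      have h1 : Real.exp (q * L) ≤ Real.exp (q * (oscConst D Ω w + 1)) := by gcongr
      have h2 := Real.exp_pos (q * (oscConst D Ω w + 1) * r)
      linarith
    have hB2 : 4 * Real.exp (q * L * r) ≤ B := by
      have h1 : Real.exp (q * L * r) ≤ Real.exp (q * (oscConst D Ω w + 1) * r) := by gcongr
      have h2 := Real.exp_pos (q * (oscConst D Ω w + 1))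
      linarith
    obtain ⟨hVI, hA, hS⟩ := hV I hI
    filter_upwards [hv.exists_tile_bound hD hΩm hp hposv hoscv hB1 hB2 hI hIΩ,
      ae_mono (Measure.restrict_mono_set area hIΩ) hw.pos] with z ⟨hz, h1, h2⟩ hwz
    have hwq : (w z ^ q) ^ (1 / q) = w z := by
      rw [← Real.rpow_mul hwz.le, mul_one_div_cancel hq0.ne', Real.rpow_one]
    have k1 : w z ^ q ≤ c * V I := h1.trans (by
      rw [hc']
      exact mul_le_mul (le_max_left _ _) hA (hD.avg_nonneg hI _) (by positivity))
    -- The lower bound for `w ^ q` comes from the dual side: `(w ^ q) ^ (-r)` is controlled by the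
    -- average of `s₀`, hence by `V I ^ (-r)`.
    have k2 : V I ≤ c * w z ^ q := by
      have h3 : (w z ^ q) ^ (-r) ≤ B * (N + 1) ^ r * V I ^ (-r) := by
        have h4 : avg s₀ I ≤ (N + 1) ^ r * V I ^ (-r) := by
          rw [havgs, hC, Real.rpow_neg (by positivity), inv_mul_le_iff₀ (by positivity)] at hS
          exact hS
        calc _ ≤ B * avg s₀ I := h2
          _ ≤ B * ((N + 1) ^ r * V I ^ (-r)) := by gcongr
          _ = _ := by ring
      refine (le_of_rpow_neg_le hr0 hz hVI hBpos (by positivity) h3).trans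
        (mul_le_mul_of_nonneg_right ?_ hz.le)
      rw [hri]
      rw [hc']; exact le_max_right _ _
    refine ⟨hwz, ?_, ?_⟩
    · have := Real.rpow_le_rpow hz.le k1 hδ0.le
      rw [hwq, Real.mul_rpow (by linarith) hVI.le] at this
      exact this.trans (by gcongr)
    · have := Real.rpow_le_rpow hVI.le k2 hδ0.le
      rw [Real.mul_rpow (by linarith) hz.le, hwq] at this
      exact this.trans (by gcongr)
  let W : ℂ → ℝ := fun z => if z ∈ Ω then w z else V (gridArc D z) ^ (1 / q)
  -- Here it matters that `Ω` is a union of whole tiles: `W` is given by a single formula on each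
  -- tile.
  have hcase : ∀ I ∈ D, topHalf I ⊆ Ω ∨ Disjoint (topHalf I) Ω := by
    intro I hI
    by_cases h : I ∈ 𝒥
    · left; rw [hΩ]; exact subset_biUnion_of_mem h
    · right
      refine Set.disjoint_left.2 fun z hz hzΩ => h ?_
      rw [hΩ] at hzΩ
      obtain ⟨J, hJ, hzJ⟩ := mem_iUnion₂.1 hzΩ
      rw [hD.eq_of_mem_topHalf hI (h𝒥 hJ) hz hzJ]
      exact hJ
  have hWin : ∀ I ∈ D, topHalf I ⊆ Ω → ∀ᵐ z ∂area.restrict (topHalf I), W z = w z := by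
    intro I hI hIΩ
    filter_upwards [ae_restrict_mem (hD.measurableSet_topHalf hI)] with z hz
    exact if_pos (hIΩ hz)
  have hWout : ∀ I ∈ D, Disjoint (topHalf I) Ω →
      ∀ᵐ z ∂area.restrict (topHalf I), W z = V I ^ (1 / q) := by
    intro I hI hIΩ
    filter_upwards [ae_restrict_mem (hD.measurableSet_topHalf hI)] with z hz
    rw [← hD.gridArc_eq hI hz]
    exact if_neg (Set.disjoint_left.1 hIΩ hz)
  have hWmeas : ∀ I ∈ D, AEMeasurable W (area.restrict (topHalf I)) := by
    intro I hI
    rcases hcase I hI with h | h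
    · exact (hw.aemeasurable.mono_measure (Measure.restrict_mono_set area h)).congr
        ((hWin I hI h).mono fun z hz => hz.symm)
    · exact (aemeasurable_const (b := V I ^ (1 / q))).congr
        ((hWout I hI h).mono fun z hz => hz.symm)
  have hWtile : ∀ I ∈ D, ∀ᵐ z ∂area.restrict (topHalf I),
      0 < W z ∧ W z ≤ c * V I ^ (1 / q) ∧ V I ^ (1 / q) ≤ c * W z := by
    intro I hI
    rcases hcase I hI with h | h
    · filter_upwards [hWin I hI h, htile I hI h] with z h1 h2
      rwa [h1]
    · filter_upwards [hWout I hI h] with z h1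
      have := Real.rpow_pos_of_pos (hV I hI).1 (1 / q)
      rw [h1]
      exact ⟨this, le_mul_of_one_le_left this.le hc1, le_mul_of_one_le_left this.le hc1⟩
  obtain ⟨r1, r2, r3, r4⟩ := hD.memBp_of_tile hp hf hs hV hedge hδ0 hδ1 hc1 hWmeas hWtile
  refine ⟨W, r1, r2, ?_, r3, r4⟩
  filter_upwards [ae_restrict_mem hΩm] with z hz
  exact if_pos hz

end Extension

end DyadicWeights

theorem theorem2 :
    (∃ M₁ M₂ : ℝ → ℝ → ℝ → ℝ → ℝ,
      ∀ (p q : ℝ), 1 < p → 1 < q →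
      ∀ (D : Set (Set Circle)), DyadicWeights.IsDyadicGrid D →
      ∀ (𝒥 : Set (Set Circle)), 𝒥 ⊆ D →
      ∀ (Ω : Set ℂ), Ω = ⋃ I ∈ 𝒥, DyadicWeights.topHalf I →
      ∀ (w : ℂ → ℝ), DyadicWeights.IsDyadicBHO D Ω w →
        DyadicWeights.MemBp D Ω p (fun z => w z ^ q) →
        ∃ W : ℂ → ℝ,
          DyadicWeights.MemBp D DyadicWeights.disc p W ∧
          DyadicWeights.IsDyadicBHO D DyadicWeights.disc W ∧
          (∀ᵐ z ∂DyadicWeights.area.restrict Ω, W z = w z) ∧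
          DyadicWeights.bpConst D DyadicWeights.disc p W ≤
            ENNReal.ofReal (M₁ q p (DyadicWeights.oscConst D Ω w)
              (DyadicWeights.bpConst D Ω p (fun z => w z ^ q)).toReal) ∧
          DyadicWeights.oscConst D DyadicWeights.disc W ≤
            M₂ q p (DyadicWeights.oscConst D Ω w)
              (DyadicWeights.bpConst D Ω p (fun z => w z ^ q)).toReal) ∧
    (∀ (p : ℝ), 1 < p →
      ∀ (D : Set (Set Circle)), DyadicWeights.IsDyadicGrid D →
      ∀ (𝒥 : Set (Set Circle)), 𝒥 ⊆ D →
      ∀ (Ω : Set ℂ), Ω = ⋃ I ∈ 𝒥, DyadicWeights.topHalf I →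
      ∀ (w W : ℂ → ℝ),
        DyadicWeights.MemBp D DyadicWeights.disc p W →
        DyadicWeights.IsDyadicBHO D DyadicWeights.disc W →
        (∀ᵐ z ∂DyadicWeights.area.restrict Ω, W z = w z) →
        ∃ q : ℝ, 1 < q ∧ DyadicWeights.MemBp D Ω p (fun z => w z ^ q)) := by
  constructor
  · refine ⟨fun q p L N => DyadicWeights.ratioBound q p (L + 1) N / (1 - 1 / q) *
      (DyadicWeights.ratioBound q p (L + 1) N ^ (p - 1)⁻¹ / (1 - 1 / q)) ^ (p - 1),
      fun q p L N => 2 * Real.log (DyadicWeights.ratioBound q p (L + 1) N) +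
        2 * (p * Real.log 4), ?_⟩
    intro p q hp hq D hD 𝒥 h𝒥 Ω hΩ w hw hv
    exact hw.exists_extension hD hp hq h𝒥 hΩ hv rfl
  · intro p hp D hD 𝒥 h𝒥 Ω hΩ w W hW hB hae
    refine hW.exists_rpow hD hp hB (hΩ ▸ hD.measurableSet_biUnion h𝒥) ?_ hae
    rw [hΩ]
    exact iUnion₂_subset fun I _ z hz => hz.1.1
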